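/- Let $n\ge 1$, $a=\exp(2\pi i/2n)$, and let $\tilde D=\mathrm{diag}(1,a,\dots,a^{2n-1})$ and $\tilde S$ (the cyclic shift, with entries $1$ in the positions $(i,i+1)$, indices modulo $2n$) be Sylvester's generators, regarded as an even and an odd supermatrix on the $(n|n)$-dimensional complex superspace with alternating format (even, odd, even, odd, …). Let $F$ be the free complex Lie superalgebra on an even generator $D$ and an odd generator $S$, and let $\mathrm{ev}:F\to\mathfrak{gl}(n|n)$ be the morphism with $D\mapsto\tilde D$, $S\mapsto\tilde S$. A set of homogeneous elements of $F$ is called a defining set of relations if the ideal that it generates is $\ker(\mathrm{ev})$; let $R(n)$, the number of independent relations between Sylvester's generators, be the least number of elements of a defining set of relations. For $1\le k,m\le 2n$ put $T_m^k=(\mathrm{ad}\,D)^{k-1}(\mathrm{ad}\,S)^{m-1}[D,S]$ if $m<2n$, and $T_{2n}^k=[S,T_{2n-1}^k]$. (1) If $n=1$, then $\tilde D,\tilde S$ generate $\mathfrak{gl}(1|1)$, the relations $$[D,[D,S]]=4S,\quad [S,[D,S]]=0,\quad [D,[S,S]]=0,\quad [S,[S,S]]=0$$ form a defining set, and $R(1)\le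 4$. (2) If $n>1$, then $\tilde D,\tilde S$ generate $\mathfrak{sl}(n|n)$, and $R(n)\le (2n)^2-1$. Moreover $\mathrm{ev}(T_{2n}^{2n})$ is a nonzero multiple of the identity matrix; the two paths $(\mathrm{ad}\,D)(\mathrm{ad}\,S)(\mathrm{ad}\,D)S$ and $(\mathrm{ad}\,S)(\mathrm{ad}\,D)^2S$ to $T_2^2$ are linearly independent in $F$; and for suitable coefficients $b_m,c_{m,k},d\in\mathbb C$ the following relations form a defining set with at most $(2n)^2-1$ elements: - $(\mathrm{ad}\,D)^{2n}S=b_1S$ and $[S,T_{2n-1}^1]=c_{2n-1,1}D$; - $(\mathrm{ad}\,D)^{2n}T_m^1=b_mT_m^1$ for $3\le m\le 2n-1$; - $T_{2n}^n=0$; and $[D,T_{2n}^k]=0$ and $[S,T_{2n}^k]=c_{2n,k}T_1^k$ for $2\le k\le 2n-1$, $k\neq n$; - $[S,T_1^k]=c_{1,k}T_2^k$ for $3\le k\le 2n-1$, and $[S,T_m^k]=c_{m,k}T_{m+1}^k$ for $2\le m\le 2n-2$, $2\le k\le 2n$; - $[S,S]=d\,T_2^{2n}$; - the relations from the identity element,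 $[D,T_{2n}^{2n}]=[S,T_{2n}^{2n}]=0$; - the relation between the two paths to $T_2^2$, $[S,T_1^2]=c_{1,2}T_2^2$. -/

import Mathlib

/-! ### Lie superalgebras over `ℂ` -/

/-- The sign `(-1)^{kl}` attached to two parities `k, l ∈ ℤ/2`. -/
noncomputable def superSign (k l : ZMod 2) : ℂ := (-1) ^ (k.val * l.val)

/-- The structure of a complex Lie superalgebra on a vector space `L`: a decomposition into an even
part `part 0` and an odd part `part 1`, and a bilinear superbracket that is graded,
super-skew-symmetric and satisfies the super Jacobi identity on homogeneous elements. -/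
structure LieSuperalgebra (L : Type*) [AddCommGroup L] [Module ℂ L] where
  part : ZMod 2 → Submodule ℂ L
  isCompl : IsCompl (part 0) (part 1)
  bracket : L →ₗ[ℂ] L →ₗ[ℂ] L
  bracket_mem : ∀ {k l : ZMod 2} {x y : L}, x ∈ part k → y ∈ part l → bracket x y ∈ part (k + l)
  skew : ∀ {k l : ZMod 2} {x y : L}, x ∈ part k → y ∈ part l →
    bracket x y = -(superSign k l • bracket y x)
  jacobi : ∀ {k l m : ZMod 2} {x y z : L}, x ∈ part k → y ∈ part l → z ∈ part m →
    bracket x (bracket y z) = bracket (bracket x y) z + superSign k l • bracket y (bracket x z)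

/-- Morphisms of Lie superalgebras: parity preserving linear maps compatible with the brackets. -/
structure LieSuperalgebra.Hom {L M : Type*} [AddCommGroup L] [Module ℂ L] [AddCommGroup M]
    [Module ℂ M] (G : LieSuperalgebra L) (H : LieSuperalgebra M) where
  toLinearMap : L →ₗ[ℂ] M
  map_part : ∀ {k : ZMod 2} {x : L}, x ∈ G.part k → toLinearMap x ∈ H.part k
  map_bracket : ∀ x y : L, toLinearMap (G.bracket x y) = H.bracket (toLinearMap x) (toLinearMap y)

/-- The two-sided ideal generated by a set of elements. -/
def LieSuperalgebra.idealSpan {L : Type*} [AddCommGroup L] [Module ℂ L] (G : LieSuperalgebra L)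
    (s : Set L) : Submodule ℂ L :=
  sInf {I | s ⊆ I ∧ ∀ x, ∀ y ∈ I, G.bracket x y ∈ I ∧ G.bracket y x ∈ I}

/-- An element is homogeneous if it is even or odd. -/
def LieSuperalgebra.IsHomogeneous {L : Type*} [AddCommGroup L] [Module ℂ L]
    (G : LieSuperalgebra L) (x : L) : Prop :=
  ∃ k, x ∈ G.part k

/-! ### The free Lie superalgebra on a set of generators with parities -/

section Free

variable {X : Type*}

/-- The parity automorphism of the free nonassociative algebra on the generators `X` of parities
`p`: it multiplies a word in the generators by `1` or `-1`, according to whether the number of odd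
letters is even or odd. -/
noncomputable def parityAut (p : X → ZMod 2) :
    FreeNonUnitalNonAssocAlgebra ℂ X →ₙₐ[ℂ] FreeNonUnitalNonAssocAlgebra ℂ X :=
  FreeNonUnitalNonAssocAlgebra.lift ℂ
    (fun x => ((-1 : ℂ) ^ (p x).val) • FreeNonUnitalNonAssocAlgebra.of ℂ x)

/-- The even and the odd part of the free nonassociative superalgebra: the linear combinations of
words with an even, respectively odd, number of odd letters. -/
noncomputable def wordPart (p : X → ZMod 2) (k : ZMod 2) :
    Submodule ℂ (FreeNonUnitalNonAssocAlgebra ℂ X) where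
  carrier := {w | parityAut p w = ((-1 : ℂ) ^ k.val) • w}
  add_mem' := by
    intro a b ha hb
    simp only [Set.mem_ofPred_eq] at *
    rw [map_add, ha, hb, smul_add]
  zero_mem' := by simp
  smul_mem' := by
    intro c a ha
    simp only [Set.mem_ofPred_eq] at *
    rw [map_smul, ha, smul_comm]

/-- The super-skew-symmetry and super Jacobi expressions in homogeneous elements of the free
nonassociative superalgebra. -/
inductive IsSuperIdentity (p : X → ZMod 2) : FreeNonUnitalNonAssocAlgebra ℂ X → Prop
  | skew {k l : ZMod 2} {x y : FreeNonUnitalNonAssocAlgebra ℂ X} :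
      x ∈ wordPart p k → y ∈ wordPart p l → IsSuperIdentity p (x * y + superSign k l • (y * x))
  | jacobi {k l m : ZMod 2} {x y z : FreeNonUnitalNonAssocAlgebra ℂ X} :
      x ∈ wordPart p k → y ∈ wordPart p l → z ∈ wordPart p m →
      IsSuperIdentity p (x * (y * z) - (x * y) * z - superSign k l • (y * (x * z)))

/-- The submodules that are two-sided ideals and contain all the super identities. -/
def IsIdentityIdeal (p : X → ZMod 2) (I : Submodule ℂ (FreeNonUnitalNonAssocAlgebra ℂ X)) : Prop :=
  (∀ w, IsSuperIdentity p w → w ∈ I) ∧ ∀ x, ∀ y ∈ I, x * y ∈ I ∧ y * x ∈ I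

/-- The two-sided ideal generated by the super identities. -/
noncomputable def identityIdeal (p : X → ZMod 2) : Submodule ℂ (FreeNonUnitalNonAssocAlgebra ℂ X) :=
  sInf {I | IsIdentityIdeal p I}

theorem identityIdeal_isIdentityIdeal (p : X → ZMod 2) : IsIdentityIdeal p (identityIdeal p) := by
  refine ⟨fun w hw => ?_, fun x y hy => ⟨?_, ?_⟩⟩
  · exact Submodule.mem_sInf.2 fun I hI => hI.1 w hw
  · exact Submodule.mem_sInf.2 fun I hI => (hI.2 x y (Submodule.mem_sInf.1 hy I hI)).1
  · exact Submodule.mem_sInf.2 fun I hI => (hI.2 x y (Submodule.mem_sInf.1 hy I hI)).2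

theorem identityIdeal_le {p : X → ZMod 2} {I : Submodule ℂ (FreeNonUnitalNonAssocAlgebra ℂ X)}
    (hI : IsIdentityIdeal p I) : identityIdeal p ≤ I := sInf_le hI

theorem neg_one_pow_val_add (k l : ZMod 2) :
    ((-1 : ℂ) ^ (k + l).val) = (-1) ^ k.val * (-1) ^ l.val := by
  rw [← pow_add, ZMod.val_add]
  exact (neg_one_pow_eq_pow_mod_two _).symm

theorem neg_one_pow_val_mul_self (k : ZMod 2) : ((-1 : ℂ) ^ k.val) * (-1) ^ k.val = 1 := by
  rw [← pow_add, Even.neg_one_pow ⟨_, rfl⟩]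

theorem parityAut_parityAut (p : X → ZMod 2) (w : FreeNonUnitalNonAssocAlgebra ℂ X) :
    parityAut p (parityAut p w) = w := by
  have h : (parityAut p).comp (parityAut p) = NonUnitalAlgHom.id ℂ _ := by
    apply FreeNonUnitalNonAssocAlgebra.hom_ext
    intro x
    simp [parityAut, smul_smul, neg_one_pow_val_mul_self]
  exact DFunLike.congr_fun h w

theorem mul_mem_wordPart {p : X → ZMod 2} {k l : ZMod 2}
    {x y : FreeNonUnitalNonAssocAlgebra ℂ X}
    (hx : x ∈ wordPart p k) (hy : y ∈ wordPart p l) : x * y ∈ wordPart p (k + l) := by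
  change parityAut p x = _ at hx
  change parityAut p y = _ at hy
  change parityAut p (x * y) = _
  rw [map_mul, hx, hy, smul_mul_smul_comm, neg_one_pow_val_add]

theorem wordPart_sup (p : X → ZMod 2) : wordPart p 0 ⊔ wordPart p 1 = ⊤ := by
  rw [eq_top_iff]
  intro w _
  have e : w = (2⁻¹ : ℂ) • (w + parityAut p w) + (2⁻¹ : ℂ) • (w - parityAut p w) := by
    rw [← smul_add, add_add_sub_cancel, ← two_smul ℂ w, smul_smul]; norm_num
  rw [e]
  refine Submodule.add_mem_sup (Submodule.smul_mem _ _ ?_) (Submodule.smul_mem _ _ ?_)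
  · change parityAut p _ = _
    rw [map_add, parityAut_parityAut]
    simp [add_comm]
  · change parityAut p _ = _
    rw [map_sub, parityAut_parityAut]
    simp [ZMod.val_one]

/-- The parity automorphism as a linear map. -/
noncomputable def parityLin (p : X → ZMod 2) :
    FreeNonUnitalNonAssocAlgebra ℂ X →ₗ[ℂ] FreeNonUnitalNonAssocAlgebra ℂ X where
  toFun := parityAut p
  map_add' := map_add _
  map_smul' := fun c x => map_smul _ c x

theorem identityIdeal_le_comap (p : X → ZMod 2) :
    identityIdeal p ≤ (identityIdeal p).comap (parityLin p) := by
  apply identityIdeal_le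
  have hI := identityIdeal_isIdentityIdeal p
  refine ⟨fun w hw => ?_, fun x y hy => ⟨?_, ?_⟩⟩
  · change parityAut p w ∈ identityIdeal p
    cases hw with
    | @skew k l x y hx hy =>
      have : parityAut p (x * y + superSign k l • (y * x)) =
          ((-1 : ℂ) ^ (k + l).val) • (x * y + superSign k l • (y * x)) := by
        have h1 : parityAut p (x * y) = _ := mul_mem_wordPart hx hy
        have h2 : parityAut p (y * x) = _ := mul_mem_wordPart hy hx
        rw [map_add, map_smul, h1, h2, smul_add, add_comm l k, smul_comm (superSign k l)]
      rw [this]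
      exact Submodule.smul_mem _ _ (hI.1 _ (.skew hx hy))
    | @jacobi k l m x y z hx hy hz =>
      have : parityAut p (x * (y * z) - (x * y) * z - superSign k l • (y * (x * z))) =
          ((-1 : ℂ) ^ (k + l + m).val) •
            (x * (y * z) - (x * y) * z - superSign k l • (y * (x * z))) := by
        have h1 : parityAut p (x * (y * z)) = _ :=
          mul_mem_wordPart hx (mul_mem_wordPart hy hz)
        have h2 : parityAut p ((x * y) * z) = _ :=
          mul_mem_wordPart (mul_mem_wordPart hx hy) hz
        have h3 : parityAut p (y * (x * z)) = _ :=
          mul_mem_wordPart hy (mul_mem_wordPart hx hz)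
        rw [map_sub, map_sub, map_smul, h1, h2, h3, smul_sub, smul_sub,
          smul_comm (superSign k l), ← add_assoc, ← add_assoc, add_comm l k]
      rw [this]
      exact Submodule.smul_mem _ _ (hI.1 _ (.jacobi hx hy hz))
  · change parityAut p (x * y) ∈ identityIdeal p
    rw [map_mul]
    exact (hI.2 _ _ hy).1
  · change parityAut p (y * x) ∈ identityIdeal p
    rw [map_mul]
    exact (hI.2 _ _ hy).2

/-- The underlying vector space of the free Lie superalgebra on generators `X` of parities `p`. -/
abbrev FreeLieSuper (p : X → ZMod 2) : Type _ :=
  FreeNonUnitalNonAssocAlgebra ℂ X ⧸ identityIdeal p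

/-- The bracket of the free Lie superalgebra, induced by the product of words. -/
noncomputable def freeBracket (p : X → ZMod 2) :
    FreeLieSuper p →ₗ[ℂ] FreeLieSuper p →ₗ[ℂ] FreeLieSuper p :=
  (identityIdeal p).liftQ
    { toFun := fun a => (identityIdeal p).liftQ
        ((identityIdeal p).mkQ.comp (LinearMap.mul ℂ (FreeNonUnitalNonAssocAlgebra ℂ X) a))
        (fun y hy => by
          rw [LinearMap.mem_ker, LinearMap.comp_apply, Submodule.mkQ_apply,
            Submodule.Quotient.mk_eq_zero]
          exact ((identityIdeal_isIdentityIdeal p).2 a y hy).1)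
      map_add' := fun a b => by
        ext y
        simp
      map_smul' := fun c a => by
        ext y
        simp }
    (fun x hx => by
      rw [LinearMap.mem_ker]
      apply Submodule.linearMap_qext
      apply LinearMap.ext
      intro y
      change (Submodule.Quotient.mk (x * y) : FreeLieSuper p) = 0
      rw [Submodule.Quotient.mk_eq_zero]
      exact ((identityIdeal_isIdentityIdeal p).2 y x hx).2)

theorem freeBracket_mk (p : X → ZMod 2) (x y : FreeNonUnitalNonAssocAlgebra ℂ X) :
    freeBracket p ((identityIdeal p).mkQ x) ((identityIdeal p).mkQ y) =
      (identityIdeal p).mkQ (x * y) := rfl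

/-- The free Lie superalgebra on generators `X` of parities `p`: the quotient of the free
nonassociative superalgebra by the ideal of super identities. -/
noncomputable def freeLieSuperalgebra (p : X → ZMod 2) : LieSuperalgebra (FreeLieSuper p) where
  part k := (wordPart p k).map (identityIdeal p).mkQ
  isCompl := by
    constructor
    · rw [Submodule.disjoint_def]
      rintro _ ⟨x, hx, rfl⟩ ⟨y, hy, hxy⟩
      have key := (Submodule.Quotient.eq _).1 hxy
      have hm : parityAut p (y - x) ∈ identityIdeal p := identityIdeal_le_comap p key
      change parityAut p x = _ at hx
      change parityAut p y = _ at hy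
      rw [map_sub, hx, hy] at hm
      have h2 := Submodule.add_mem _ key hm
      have e : y - x + (((-1 : ℂ) ^ (1 : ZMod 2).val) • y - ((-1 : ℂ) ^ (0 : ZMod 2).val) • x)
          = (-2 : ℂ) • x := by
        simp only [ZMod.val_one, ZMod.val_zero, pow_one, pow_zero, neg_smul, one_smul, two_smul]
        abel
      rw [e] at h2
      have h3 := Submodule.smul_mem _ (-2 : ℂ)⁻¹ h2
      rw [smul_smul, inv_mul_cancel₀ (by norm_num), one_smul] at h3
      exact (Submodule.Quotient.mk_eq_zero _).2 h3
    · rw [codisjoint_iff, ← Submodule.map_sup, wordPart_sup, Submodule.map_top,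
        Submodule.range_mkQ]
  bracket := freeBracket p
  bracket_mem := by
    rintro k l _ _ ⟨x, hx, rfl⟩ ⟨y, hy, rfl⟩
    exact ⟨x * y, mul_mem_wordPart hx hy, rfl⟩
  skew := by
    rintro k l _ _ ⟨x, hx, rfl⟩ ⟨y, hy, rfl⟩
    rw [freeBracket_mk, freeBracket_mk, eq_neg_iff_add_eq_zero, ← map_smul, ← map_add]
    exact (Submodule.Quotient.mk_eq_zero _).2
      ((identityIdeal_isIdentityIdeal p).1 _ (.skew hx hy))
  jacobi := by
    rintro k l m _ _ _ ⟨x, hx, rfl⟩ ⟨y, hy, rfl⟩ ⟨z, hz, rfl⟩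
    simp only [freeBracket_mk]
    rw [← sub_eq_zero, ← sub_sub, ← map_smul, ← map_sub, ← map_sub]
    exact (Submodule.Quotient.mk_eq_zero _).2
      ((identityIdeal_isIdentityIdeal p).1 _ (.jacobi hx hy hz))

/-- A generator as an element of the free Lie superalgebra. -/
noncomputable def freeGen (p : X → ZMod 2) (x : X) : FreeLieSuper p :=
  (identityIdeal p).mkQ (FreeNonUnitalNonAssocAlgebra.of ℂ x)

variable {L : Type*} [AddCommGroup L] [Module ℂ L]

/-- The bracket of a Lie superalgebra regarded as a nonassociative product. -/
abbrev LieSuperalgebra.toRing (G : LieSuperalgebra L) : NonUnitalNonAssocRing L :=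
  { (inferInstance : AddCommGroup L) with
    mul := fun x y => G.bracket x y
    left_distrib := fun x y z => map_add (G.bracket x) y z
    right_distrib := fun x y z => LinearMap.map_add₂ G.bracket x y z
    zero_mul := fun x => LinearMap.map_zero₂ G.bracket x
    mul_zero := fun x => map_zero (G.bracket x) }

/-- The linear map on the free nonassociative algebra that extends a given assignment of the
generators and sends products of words to brackets. -/
noncomputable def LieSuperalgebra.wordLift (G : LieSuperalgebra L) (f : X → L) :
    FreeNonUnitalNonAssocAlgebra ℂ X →ₗ[ℂ] L :=
  let _ : NonUnitalNonAssocRing L := G.toRing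
  have _ : IsScalarTower ℂ L L := ⟨fun c x y => LinearMap.map_smul₂ G.bracket c x y⟩
  have _ : SMulCommClass ℂ L L := ⟨fun c x y => ((G.bracket x).map_smul c y).symm⟩
  let F : FreeNonUnitalNonAssocAlgebra ℂ X →ₙₐ[ℂ] L := FreeNonUnitalNonAssocAlgebra.lift ℂ f
  { toFun := F, map_add' := map_add F, map_smul' := fun c x => map_smul F c x }

theorem LieSuperalgebra.wordLift_of (G : LieSuperalgebra L) (f : X → L) (x : X) :
    G.wordLift f (FreeNonUnitalNonAssocAlgebra.of ℂ x) = f x := by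
  let _ : NonUnitalNonAssocRing L := G.toRing
  have _ : IsScalarTower ℂ L L := ⟨fun c x y => LinearMap.map_smul₂ G.bracket c x y⟩
  have _ : SMulCommClass ℂ L L := ⟨fun c x y => ((G.bracket x).map_smul c y).symm⟩
  exact FreeNonUnitalNonAssocAlgebra.lift_of_apply ℂ f x

theorem LieSuperalgebra.wordLift_mul (G : LieSuperalgebra L) (f : X → L)
    (x y : FreeNonUnitalNonAssocAlgebra ℂ X) :
    G.wordLift f (x * y) = G.bracket (G.wordLift f x) (G.wordLift f y) := by
  let _ : NonUnitalNonAssocRing L := G.toRing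
  have _ : IsScalarTower ℂ L L := ⟨fun c x y => LinearMap.map_smul₂ G.bracket c x y⟩
  have _ : SMulCommClass ℂ L L := ⟨fun c x y => ((G.bracket x).map_smul c y).symm⟩
  let F : FreeNonUnitalNonAssocAlgebra ℂ X →ₙₐ[ℂ] L := FreeNonUnitalNonAssocAlgebra.lift ℂ f
  exact map_mul F x y

/-- Every element is the sum of an even and an odd element. -/
theorem LieSuperalgebra.exists_add (G : LieSuperalgebra L) (x : L) :
    ∃ y ∈ G.part 0, ∃ z ∈ G.part 1, y + z = x :=
  Submodule.mem_sup.1 (G.isCompl.sup_eq_top ▸ Submodule.mem_top)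

/-- The parity automorphism of a Lie superalgebra. -/
theorem LieSuperalgebra.exists_parity (G : LieSuperalgebra L) :
    ∃ θ : L →ₗ[ℂ] L, (∀ k : ZMod 2, ∀ x ∈ G.part k, θ x = ((-1 : ℂ) ^ k.val) • x) ∧
      (∀ x y, θ (G.bracket x y) = G.bracket (θ x) (θ y)) ∧
      ∀ k : ZMod 2, ∀ x, θ x = ((-1 : ℂ) ^ k.val) • x → x ∈ G.part k := by
  let θ : L →ₗ[ℂ] L := LinearMap.ofIsCompl G.isCompl (G.part 0).subtype (-(G.part 1).subtype)
  have h0 : ∀ x ∈ G.part 0, θ x = x := fun x hx =>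
    LinearMap.ofIsCompl_apply_left G.isCompl ⟨x, hx⟩
  have h1 : ∀ x ∈ G.part 1, θ x = -x := fun x hx =>
    LinearMap.ofIsCompl_apply_right G.isCompl ⟨x, hx⟩
  have hk : ∀ k : ZMod 2, ∀ x ∈ G.part k, θ x = ((-1 : ℂ) ^ k.val) • x := by
    intro k x hx
    have hk : k = 0 ∨ k = 1 := by clear * -; revert k; decide
    rcases hk with rfl | rfl
    · simpa using h0 x hx
    · simpa [ZMod.val_one] using h1 x hx
  refine ⟨θ, hk, fun x y => ?_, fun k x hx => ?_⟩
  · have hom : ∀ k l : ZMod 2, ∀ x ∈ G.part k, ∀ y ∈ G.part l,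
        θ (G.bracket x y) = G.bracket (θ x) (θ y) := by
      intro k l x hx y hy
      rw [hk _ _ (G.bracket_mem hx hy), hk _ _ hx, hk _ _ hy, neg_one_pow_val_add, map_smul,
        LinearMap.map_smul₂, smul_smul, mul_comm]
    obtain ⟨x0, hx0, x1, hx1, rfl⟩ := G.exists_add x
    obtain ⟨y0, hy0, y1, hy1, rfl⟩ := G.exists_add y
    simp only [map_add, LinearMap.add_apply, hom _ _ _ hx0 _ hy0, hom _ _ _ hx0 _ hy1,
      hom _ _ _ hx1 _ hy0, hom _ _ _ hx1 _ hy1]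
  · obtain ⟨x0, hx0, x1, hx1, rfl⟩ := G.exists_add x
    rw [map_add, h0 _ hx0, h1 _ hx1] at hx
    have hk : k = 0 ∨ k = 1 := by clear * -; revert k; decide
    rcases hk with rfl | rfl
    · have h : (2 : ℂ) • x1 = 0 := by
        rw [two_smul]
        simp only [ZMod.val_zero, pow_zero, one_smul] at hx
        have := add_left_cancel hx
        nth_rewrite 1 [← this]
        simp
      have := (smul_eq_zero.1 h).resolve_left two_ne_zero
      simpa [this] using hx0
    · have h : (2 : ℂ) • x0 = 0 := by
        rw [two_smul]
        simp only [ZMod.val_one, pow_one, neg_smul, one_smul, neg_add] at hx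
        have := add_right_cancel hx
        nth_rewrite 1 [this]
        simp
      have := (smul_eq_zero.1 h).resolve_left two_ne_zero
      simpa [this] using hx1

theorem LieSuperalgebra.wordLift_mem (G : LieSuperalgebra L) {p : X → ZMod 2} {f : X → L}
    (hf : ∀ x, f x ∈ G.part (p x)) {k : ZMod 2} {w : FreeNonUnitalNonAssocAlgebra ℂ X}
    (hw : w ∈ wordPart p k) : G.wordLift f w ∈ G.part k := by
  obtain ⟨θ, hθ, hbr, hmem⟩ := G.exists_parity
  apply hmem
  have comm : ∀ w, G.wordLift f (parityAut p w) = θ (G.wordLift f w) := by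
    let _ : NonUnitalNonAssocRing L := G.toRing
    have _ : IsScalarTower ℂ L L := ⟨fun c x y => LinearMap.map_smul₂ G.bracket c x y⟩
    have _ : SMulCommClass ℂ L L := ⟨fun c x y => ((G.bracket x).map_smul c y).symm⟩
    let F₁ : FreeNonUnitalNonAssocAlgebra ℂ X →ₙₐ[ℂ] L :=
      { toFun := fun w => G.wordLift f (parityAut p w)
        map_smul' := fun c x => by simp
        map_zero' := by simp
        map_add' := fun x y => by simp
        map_mul' := fun x y => by rw [map_mul, G.wordLift_mul]; rfl }
    let F₂ : FreeNonUnitalNonAssocAlgebra ℂ X →ₙₐ[ℂ] L :=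
      { toFun := fun w => θ (G.wordLift f w)
        map_smul' := fun c x => by simp
        map_zero' := by simp
        map_add' := fun x y => by simp
        map_mul' := fun x y => by rw [G.wordLift_mul, hbr]; rfl }
    have h : F₁ = F₂ := by
      apply FreeNonUnitalNonAssocAlgebra.hom_ext
      intro x
      change G.wordLift f (parityAut p _) = θ (G.wordLift f _)
      rw [G.wordLift_of, hθ _ _ (hf x), parityAut, FreeNonUnitalNonAssocAlgebra.lift_of_apply,
        map_smul, G.wordLift_of]
    intro w
    exact DFunLike.congr_fun h w
  rw [← comm]
  change parityAut p w = _ at hw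
  rw [hw, map_smul]

/-- The morphism from the free Lie superalgebra to a Lie superalgebra given by a parity preserving
assignment of the generators. -/
noncomputable def LieSuperalgebra.lift (G : LieSuperalgebra L) (p : X → ZMod 2) (f : X → L)
    (hf : ∀ x, f x ∈ G.part (p x)) : LieSuperalgebra.Hom (freeLieSuperalgebra p) G where
  toLinearMap := (identityIdeal p).liftQ (G.wordLift f) (by
    apply identityIdeal_le
    refine ⟨fun w hw => ?_, fun x y hy => ?_⟩
    · rw [LinearMap.mem_ker]
      cases hw with
      | skew hx hy =>
        rw [map_add, map_smul, G.wordLift_mul, G.wordLift_mul,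
          G.skew (G.wordLift_mem hf hx) (G.wordLift_mem hf hy), neg_add_cancel]
      | jacobi hx hy hz =>
        simp only [map_sub, map_smul, G.wordLift_mul]
        rw [G.jacobi (G.wordLift_mem hf hx) (G.wordLift_mem hf hy) (G.wordLift_mem hf hz)]
        abel
    · rw [LinearMap.mem_ker] at hy
      simp [LinearMap.mem_ker, G.wordLift_mul, hy])
  map_part := by
    rintro k _ ⟨x, hx, rfl⟩
    exact G.wordLift_mem hf hx
  map_bracket := by
    intro x y
    obtain ⟨x, rfl⟩ := Submodule.mkQ_surjective _ x
    obtain ⟨y, rfl⟩ := Submodule.mkQ_surjective _ y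
    exact G.wordLift_mul f x y

theorem LieSuperalgebra.lift_freeGen (G : LieSuperalgebra L) (p : X → ZMod 2) (f : X → L)
    (hf : ∀ x, f x ∈ G.part (p x)) (x : X) :
    (G.lift p f hf).toLinearMap (freeGen p x) = f x :=
  G.wordLift_of f x

end Free

/-! ### General linear and special linear Lie superalgebras of matrices -/

section Matrices

variable {ι : Type*}

/-- Matrices of parity `k` with respect to the row and column parities `p`: the entry in position
`(i, j)` vanishes unless `p i + p j = k`. -/
def matrixPart (p : ι → ZMod 2) (k : ZMod 2) : Submodule ℂ (Matrix ι ι ℂ) where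
  carrier := {A | ∀ i j, p i + p j ≠ k → A i j = 0}
  add_mem' := by
    intro A B hA hB i j h
    simp [hA i j h, hB i j h]
  zero_mem' := by simp
  smul_mem' := by
    intro c A hA i j h
    simp [hA i j h]

/-- The component of parity `k` of a matrix. -/
def matrixComponent (p : ι → ZMod 2) (k : ZMod 2) : Matrix ι ι ℂ →ₗ[ℂ] Matrix ι ι ℂ where
  toFun A := Matrix.of fun i j => if p i + p j = k then A i j else 0
  map_add' A B := by
    ext i j
    by_cases h : p i + p j = k <;> simp [h]
  map_smul' c A := by
    ext i j
    simp

theorem matrixComponent_mem (p : ι → ZMod 2) (k : ZMod 2) (A : Matrix ι ι ℂ) :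
    matrixComponent p k A ∈ matrixPart p k := by
  intro i j h
  simp [matrixComponent, h]

theorem matrixComponent_of_mem {p : ι → ZMod 2} {k : ZMod 2} {A : Matrix ι ι ℂ}
    (hA : A ∈ matrixPart p k) (l : ZMod 2) :
    matrixComponent p l A = if k = l then A else 0 := by
  ext i j
  by_cases h : p i + p j = k
  · by_cases hl : k = l <;> simp [matrixComponent, h, hl]
  · by_cases hl : k = l <;> simp [matrixComponent, hA i j h, hl]

variable [Fintype ι]

theorem matrixPart_mul {p : ι → ZMod 2} {k l : ZMod 2} {A B : Matrix ι ι ℂ}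
    (hA : A ∈ matrixPart p k) (hB : B ∈ matrixPart p l) : A * B ∈ matrixPart p (k + l) := by
  intro i j h
  rw [Matrix.mul_apply]
  apply Finset.sum_eq_zero
  intro m _
  by_cases h1 : p i + p m = k
  · by_cases h2 : p m + p j = l
    · exfalso
      apply h
      rw [← h1, ← h2]
      generalize p i = a
      generalize p m = b
      generalize p j = c
      revert a b c
      decide
    · rw [hB m j h2, mul_zero]
  · rw [hA i m h1, zero_mul]

/-- The superbracket of matrices: `AB - (-1)^{kl} BA` for `A` of parity `k` and `B` of parity `l`,
extended bilinearly. -/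
noncomputable def matrixSuperbracket (p : ι → ZMod 2) :
    Matrix ι ι ℂ →ₗ[ℂ] Matrix ι ι ℂ →ₗ[ℂ] Matrix ι ι ℂ :=
  LinearMap.mk₂ ℂ
    (fun A B => ∑ k : ZMod 2, ∑ l : ZMod 2,
      (matrixComponent p k A * matrixComponent p l B -
        superSign k l • (matrixComponent p l B * matrixComponent p k A)))
    (fun A A' B => by
      simp only [map_add, add_mul, mul_add, smul_add, ← Finset.sum_add_distrib]
      refine Finset.sum_congr rfl fun k _ => Finset.sum_congr rfl fun l _ => ?_
      abel)
    (fun c A B => by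
      simp only [map_smul, smul_mul_assoc, mul_smul_comm, Finset.smul_sum, smul_sub]
      refine Finset.sum_congr rfl fun k _ => Finset.sum_congr rfl fun l _ => ?_
      rw [smul_comm c])
    (fun A B B' => by
      simp only [map_add, add_mul, mul_add, smul_add, ← Finset.sum_add_distrib]
      refine Finset.sum_congr rfl fun k _ => Finset.sum_congr rfl fun l _ => ?_
      abel)
    (fun c A B => by
      simp only [map_smul, smul_mul_assoc, mul_smul_comm, Finset.smul_sum, smul_sub]
      refine Finset.sum_congr rfl fun k _ => Finset.sum_congr rfl fun l _ => ?_
      rw [smul_comm c])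

theorem matrixSuperbracket_apply {p : ι → ZMod 2} {k l : ZMod 2} {A B : Matrix ι ι ℂ}
    (hA : A ∈ matrixPart p k) (hB : B ∈ matrixPart p l) :
    matrixSuperbracket p A B = A * B - superSign k l • (B * A) := by
  rw [matrixSuperbracket, LinearMap.mk₂_apply]
  simp only [matrixComponent_of_mem hA, matrixComponent_of_mem hB]
  rw [Finset.sum_eq_single k, Finset.sum_eq_single l]
  · simp
  · intro b _ hb
    simp [hb.symm]
  · simp
  · intro b _ hb
    simp [hb.symm]
  · simp

theorem superSign_comm (k l : ZMod 2) : superSign k l = superSign l k := by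
  rw [superSign, superSign, mul_comm]

theorem superSign_mul_self (k l : ZMod 2) : superSign k l * superSign k l = 1 := by
  rw [superSign, ← pow_add, Even.neg_one_pow ⟨_, rfl⟩]

theorem superSign_add_left (k l m : ZMod 2) :
    superSign (k + l) m = superSign k m * superSign l m := by
  rw [superSign, pow_mul, neg_one_pow_val_add, mul_pow, ← pow_mul, ← pow_mul]
  rfl

/-- The general linear Lie superalgebra of matrices with row and column parities `p`. -/
noncomputable def glSuper (p : ι → ZMod 2) : LieSuperalgebra (Matrix ι ι ℂ) where
  part := matrixPart p
  isCompl := by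
    constructor
    · rw [Submodule.disjoint_def]
      intro A h0 h1
      ext i j
      by_cases h : p i + p j = 0
      · exact h1 i j (by rw [h]; decide)
      · exact h0 i j h
    · rw [codisjoint_iff, eq_top_iff]
      intro A _
      have e : A = matrixComponent p 0 A + matrixComponent p 1 A := by
        ext i j
        have hk : p i + p j = 0 ∨ p i + p j = 1 := by
          generalize p i + p j = k
          revert k
          decide
        rcases hk with h | h <;> simp [matrixComponent, h]
      rw [e]
      exact Submodule.add_mem_sup (matrixComponent_mem p 0 A) (matrixComponent_mem p 1 A)
  bracket := matrixSuperbracket p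
  bracket_mem := by
    intro k l A B hA hB
    rw [matrixSuperbracket_apply hA hB]
    refine Submodule.sub_mem _ (matrixPart_mul hA hB) (Submodule.smul_mem _ _ ?_)
    rw [add_comm]
    exact matrixPart_mul hB hA
  skew := by
    intro k l A B hA hB
    rw [matrixSuperbracket_apply hA hB, matrixSuperbracket_apply hB hA, superSign_comm l k,
      smul_sub, smul_smul, superSign_mul_self, one_smul, neg_sub]
  jacobi := by
    intro k l m A B C hA hB hC
    have mem : ∀ {k l : ZMod 2} {A B : Matrix ι ι ℂ}, A ∈ matrixPart p k → B ∈ matrixPart p l →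
        matrixSuperbracket p A B ∈ matrixPart p (k + l) := by
      intro k l A B hA hB
      rw [matrixSuperbracket_apply hA hB]
      refine Submodule.sub_mem _ (matrixPart_mul hA hB) (Submodule.smul_mem _ _ ?_)
      rw [add_comm]
      exact matrixPart_mul hB hA
    rw [matrixSuperbracket_apply hA (mem hB hC), matrixSuperbracket_apply (mem hA hB) hC,
      matrixSuperbracket_apply hB (mem hA hC), matrixSuperbracket_apply hB hC,
      matrixSuperbracket_apply hA hB, matrixSuperbracket_apply hA hC,
      superSign_comm k (l + m), superSign_comm l (k + m), superSign_add_left, superSign_add_left,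
      superSign_add_left, superSign_comm m k, superSign_comm m l, superSign_comm l k]
    have h1 := superSign_mul_self k l
    simp only [mul_sub, sub_mul, smul_sub, smul_smul, mul_smul_comm, smul_mul_assoc, mul_assoc]
    have e : superSign k l * (superSign k l * superSign l m) = superSign l m := by
      rw [← mul_assoc, h1, one_mul]
    have e2 : superSign k l * (superSign k l * (superSign l m * superSign k m)) =
        superSign k m * superSign l m := by
      rw [← mul_assoc, h1, one_mul, mul_comm]
    have e3 : superSign k l * (superSign k m * superSign l m) =
        superSign k m * (superSign l m * superSign k l) := by ring
    rw [e, e2, e3]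
    abel

/-- The supertrace. -/
def supertrace (p : ι → ZMod 2) : Matrix ι ι ℂ →ₗ[ℂ] ℂ where
  toFun A := ∑ i, (-1 : ℂ) ^ (p i).val * A i i
  map_add' A B := by simp [mul_add, Finset.sum_add_distrib]
  map_smul' c A := by
    simp only [Matrix.smul_apply, smul_eq_mul, Finset.mul_sum, RingHom.id_apply]
    exact Finset.sum_congr rfl fun i _ => by ring

/-- The special linear Lie superalgebra, as a subspace of the matrices: the supertraceless
matrices. -/
def slSuper (p : ι → ZMod 2) : Submodule ℂ (Matrix ι ι ℂ) :=
  LinearMap.ker (supertrace p)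

end Matrices

/-! ### Sylvester's generators -/

/-- The two Sylvester generators `D` and `S`. -/
inductive SylvesterGen
  | D
  | S

/-- `D` is even and `S` is odd. -/
def sylvesterParity : SylvesterGen → ZMod 2
  | .D => 0
  | .S => 1

/-- The alternating format even, odd, even, odd, … on the `(n|n)`-dimensional superspace. -/
def alternating (n : ℕ) (i : Fin (2 * n)) : ZMod 2 := (i.val : ZMod 2)

/-- The matrices `D = diag(1, a, …, a^{2n-1})`, with `a = exp(2πi/(2n))`, and `S`, the cyclic shift
with the entry `1` in the positions `(i, i + 1)`, the indices being taken modulo `2n`. -/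
noncomputable def sylvesterMatrix (n : ℕ) : SylvesterGen → Matrix (Fin (2 * n)) (Fin (2 * n)) ℂ
  | .D => Matrix.diagonal fun i =>
      Complex.exp (2 * Real.pi * Complex.I / ((2 * n : ℕ) : ℂ)) ^ i.val
  | .S => Matrix.of fun i j => if j.val = (i.val + 1) % (2 * n) then 1 else 0

theorem sylvesterMatrix_mem (n : ℕ) (g : SylvesterGen) :
    sylvesterMatrix n g ∈ (glSuper (alternating n)).part (sylvesterParity g) := by
  cases g with
  | D =>
    intro i j h
    apply Matrix.diagonal_apply_ne
    rintro rfl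
    exact h (CharTwo.add_self_eq_zero _)
  | S =>
    intro i j h
    simp only [sylvesterMatrix, Matrix.of_apply]
    rw [if_neg]
    intro hj
    apply h
    have h2 : ((j.val : ℕ) : ZMod 2) = ((i.val + 1 : ℕ) : ZMod 2) := by
      rw [ZMod.natCast_eq_natCast_iff', hj, Nat.mod_mod_of_dvd _ (dvd_mul_right 2 n)]
    change (i.val : ZMod 2) + (j.val : ZMod 2) = 1
    rw [h2, Nat.cast_add, ← add_assoc, CharTwo.add_self_eq_zero, zero_add, Nat.cast_one]

/-- The free Lie superalgebra on the even generator `D` and the odd generator `S`. -/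
abbrev FreeSylvester : Type := FreeLieSuper sylvesterParity

/-- The evaluation of the elements of the free Lie superalgebra on `D` and `S` at Sylvester's
matrices. -/
noncomputable def sylvesterEval (n : ℕ) :
    LieSuperalgebra.Hom (freeLieSuperalgebra sylvesterParity) (glSuper (alternating n)) :=
  (glSuper (alternating n)).lift sylvesterParity (sylvesterMatrix n) (sylvesterMatrix_mem n)

/-- The Lie superalgebra generated by Sylvester's matrices. -/
noncomputable def sylvesterSpan (n : ℕ) : Submodule ℂ (Matrix (Fin (2 * n)) (Fin (2 * n)) ℂ) :=
  LinearMap.range (sylvesterEval n).toLinearMap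

/-- A set of homogeneous elements of the free Lie superalgebra on `D` and `S` is a defining set of
relations between Sylvester's generators if the ideal that it generates consists of exactly those
elements that vanish on Sylvester's matrices. -/
def IsDefiningSet (n : ℕ) (s : Set FreeSylvester) : Prop :=
  (∀ x ∈ s, (freeLieSuperalgebra sylvesterParity).IsHomogeneous x) ∧
    (freeLieSuperalgebra sylvesterParity).idealSpan s = LinearMap.ker (sylvesterEval n).toLinearMap

/-- The number `R(n)` of independent relations between Sylvester's generators: the least number of
elements of a defining set of relations. -/
noncomputable def relationNumber (n : ℕ) : ℕ∞ :=
  ⨅ (s : Set FreeSylvester) (_ : IsDefiningSet n s), s.encard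

/-- The generator `D` of the free Lie superalgebra. -/
noncomputable def genD : FreeSylvester := freeGen sylvesterParity .D

/-- The generator `S` of the free Lie superalgebra. -/
noncomputable def genS : FreeSylvester := freeGen sylvesterParity .S

/-- `ad D` on the free Lie superalgebra. -/
noncomputable def adD : FreeSylvester →ₗ[ℂ] FreeSylvester :=
  (freeLieSuperalgebra sylvesterParity).bracket genD

/-- `ad S` on the free Lie superalgebra. -/
noncomputable def adS : FreeSylvester →ₗ[ℂ] FreeSylvester :=
  (freeLieSuperalgebra sylvesterParity).bracket genS

/-- The four relations in the case `n = 1`: `[D,[D,S]] = 4S`, `[S,[D,S]] = 0`, `[D,[S,S]] = 0`,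
`[S,[S,S]] = 0`. -/
noncomputable def relationsOne : Set FreeSylvester :=
  {adD (adD genS) - (4 : ℂ) • genS, adS (adD genS), adD (adS genS), adS (adS genS)}

/-- The elements `T_m^k` for `1 ≤ k, m ≤ 2n`:
`T_m^k = (ad D)^{k-1} (ad S)^{m-1} [D,S]` for `m < 2n`, and `T_{2n}^k = [S, T_{2n-1}^k]`. -/
noncomputable def gridT (n m k : ℕ) : FreeSylvester :=
  if m = 2 * n then adS ((adD ^ (k - 1)) ((adS ^ (m - 2)) (adD genS)))
  else (adD ^ (k - 1)) ((adS ^ (m - 1)) (adD genS))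

/-- The relation between the two paths to `T_2^2`: `(ad S)(ad D)^2 S = c T_2^2`. -/
noncomputable def relationTwoTwo (n : ℕ) (c : ℂ) : FreeSylvester :=
  adS (gridT n 1 2) - c • gridT n 2 2

/-- The relations that express that the element `T_{2n}^{2n}`, which represents a multiple of the
identity matrix, commutes with `D` and `S`. -/
noncomputable def relationsIdentity (n : ℕ) : Set FreeSylvester :=
  {adD (gridT n (2 * n) (2 * n)), adS (gridT n (2 * n) (2 * n))}

/-- The other relations read off from the grid of the elements `T_m^k`, for given coefficients:
`b` of the relations that close up horizontally, `c m k` of the step from `T_m^k` downwards,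
and `d` of `[S,S] = d T_2^{2n}`. -/
noncomputable def relationsGrid (n : ℕ) (b : ℕ → ℂ) (c : ℕ → ℕ → ℂ) (d : ℂ) : Set FreeSylvester :=
  -- the `2n`-th powers of `ad D` and `ad S`
  {(adD ^ (2 * n)) genS - b 1 • genS, adS (gridT n (2 * n - 1) 1) - c (2 * n - 1) 1 • genD} ∪
  -- the powers of `ad D` in the rows `3, …, 2n - 1`; for row `2` this follows from `[S,S]`
  {x | ∃ m, 3 ≤ m ∧ m ≤ 2 * n - 1 ∧ x = (adD ^ (2 * n)) (gridT n m 1) - b m • gridT n m 1} ∪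
  -- the last row; its `n`-th element is zero and its other elements commute with `D`
  {gridT n (2 * n) n} ∪
  {x | ∃ k, 2 ≤ k ∧ k ≤ 2 * n - 1 ∧ k ≠ n ∧ x = adD (gridT n (2 * n) k)} ∪
  {x | ∃ k, 2 ≤ k ∧ k ≤ 2 * n - 1 ∧ k ≠ n ∧
    x = adS (gridT n (2 * n) k) - c (2 * n) k • gridT n 1 k} ∪
  -- the vertical steps from row `1` to row `2`, other than the one to `T_2^2`
  {x | ∃ k, 3 ≤ k ∧ k ≤ 2 * n - 1 ∧ x = adS (gridT n 1 k) - c 1 k • gridT n 2 k} ∪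
  -- the vertical steps from row `m` to row `m + 1`
  {x | ∃ m k, 2 ≤ m ∧ m + 2 ≤ 2 * n ∧ 2 ≤ k ∧ k ≤ 2 * n ∧
    x = adS (gridT n m k) - c m k • gridT n (m + 1) k} ∪
  -- the superbracket of `S` with itself
  {adS genS - d • gridT n 2 (2 * n)}

/-! The matrices satisfy `S D = a D S`, so `ad D` and `ad S` send the monomial `D ^ k * S ^ m` to
`(1 - a ^ m)` times `D ^ (k + 1) * S ^ m` and to `(a ^ k - (-1) ^ m)` times `D ^ k * S ^ (m + 1)`.
Hence `T_m^k` evaluates to a multiple of `D ^ k * S ^ m`, and for `n > 1` the only multiple to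
vanish is that of `T_{2n}^n`. The `(2n)²` monomials form a basis of all matrices, and
`D ^ n * S ^ (2n)` is the only one of them with a nonzero supertrace, so the image of the evaluation
is `𝔰𝔩(n|n)`.

Conversely, the relations say that modulo the ideal that they generate, the brackets of `D` and of
`S` with every `T_m^k` are multiples of elements of the grid. As `D` and `S` are themselves such
multiples, the `T_m^k` span the free Lie superalgebra modulo the ideal. Only `T_{2n}^n`, which is
one of the relations, evaluates to zero, and the other values are linearly independent, so the ideal
is the whole kernel. Row `2` needs no relation of its own to close up horizontally, because
`[D, [S, S]] = 2 [S, [D, S]]` by the Jacobi identity. For `n = 1` the elements `[S, S]`, `S`, `D`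
and `[D, S]`, none of which evaluates to zero, take the place of the grid. -/

/-! ### Linear maps and families of vectors -/

section LinearMaps

variable {K V W ι : Type*} [Field K] [AddCommGroup V] [Module K V] [AddCommGroup W] [Module K W]

theorem span_range_smul_eq_span_image (γ : ι → K) (E : ι → V) :
    Submodule.span K (Set.range fun i => γ i • E i) =
      Submodule.span K (E '' {i | γ i ≠ 0}) := by
  apply le_antisymm <;> rw [Submodule.span_le]
  · rintro _ ⟨i, rfl⟩
    rcases eq_or_ne (γ i) 0 with h | h
    · simp only [h, zero_smul, SetLike.mem_coe, Submodule.zero_mem]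
    · exact Submodule.smul_mem _ _ (Submodule.subset_span ⟨i, h, rfl⟩)
  · rintro _ ⟨i, hi, rfl⟩
    exact (Submodule.smul_mem_iff _ hi).1 (Submodule.subset_span ⟨i, rfl⟩)

theorem ker_eq_span_image_of_subsingleton {f : V →ₗ[K] K} {E : ι → V}
    (hE : Submodule.span K (Set.range E) = ⊤) (hf : {i | f (E i) ≠ 0}.Subsingleton) :
    LinearMap.ker f = Submodule.span K (E '' {i | f (E i) = 0}) := by
  have hle : Submodule.span K (E '' {i | f (E i) = 0}) ≤ LinearMap.ker f := by
    rw [Submodule.span_le]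
    rintro _ ⟨i, hi, rfl⟩
    exact hi
  refine le_antisymm (fun x hx => ?_) hle
  have hsup : Submodule.span K (E '' {i | f (E i) = 0}) ⊔
      Submodule.span K (E '' {i | f (E i) ≠ 0}) = ⊤ := by
    rw [← Submodule.span_union, ← Set.image_union, ← hE, ← Set.image_univ]
    congr 2
    exact Set.union_compl_self _
  obtain ⟨y, hy, z, hz, rfl⟩ := Submodule.mem_sup.1 (hsup ▸ Submodule.mem_top (x := x))
  rw [LinearMap.mem_ker, map_add, hle hy, zero_add] at hx
  suffices z = 0 by rwa [this, add_zero]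
  rcases hf.eq_empty_or_singleton with h | ⟨i, h⟩
  · simpa [h] using hz
  · rw [h, Set.image_singleton] at hz
    obtain ⟨r, rfl⟩ := Submodule.mem_span_singleton.1 hz
    have hi : f (E i) ≠ 0 := h.ge rfl
    rw [map_smul, smul_eq_mul, mul_eq_zero, or_iff_left hi] at hx
    rw [hx, zero_smul]

theorem map_sub_div_smul_eq_zero {f : V →ₗ[K] W} {x y : V} {e : W} {r r' : K}
    (hx : f x = r • e) (hy : f y = r' • e) (hr' : r' ≠ 0) : f (x - (r / r') • y) = 0 := by
  rw [map_sub, map_smul, hx, hy, smul_smul, div_mul_cancel₀ _ hr', sub_self]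

variable {x y : V} {r : K} {U : Submodule K V}

theorem mem_of_sub_smul_mem (h : x - r • y ∈ U) (hy : y ∈ U) : x ∈ U :=
  (U.sub_mem_iff_left (U.smul_mem r hy)).1 h

theorem mem_of_sub_smul_mem_of_ne_zero (h : x - r • y ∈ U) (hr : r ≠ 0) (hx : x ∈ U) : y ∈ U :=
  (U.smul_mem_iff hr).1 ((U.sub_mem_iff_right hx).1 h)

end LinearMaps

/-! ### Ideals and morphisms of Lie superalgebras -/

namespace LieSuperalgebra

variable {L M : Type*} [AddCommGroup L] [Module ℂ L] [AddCommGroup M] [Module ℂ M]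
  {G : LieSuperalgebra L} {H : LieSuperalgebra M}

instance : CoeFun (G.Hom H) fun _ => L → M := ⟨fun φ => φ.toLinearMap⟩

theorem subset_idealSpan (s : Set L) : s ⊆ G.idealSpan s :=
  fun _ hx => Submodule.mem_sInf.2 fun _ hI => hI.1 hx

theorem bracket_mem_idealSpan {s : Set L} (x : L) {y : L} (hy : y ∈ G.idealSpan s) :
    G.bracket x y ∈ G.idealSpan s :=
  Submodule.mem_sInf.2 fun I hI => (hI.2 x y (Submodule.mem_sInf.1 hy I hI)).1

theorem bracket_self_of_even {x : L} (hx : x ∈ G.part 0) : G.bracket x x = 0 := by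
  have h := G.skew hx hx
  simp only [superSign, ZMod.val_zero, mul_zero, pow_zero, one_smul] at h
  have := IsAddTorsionFree.of_isTorsionFree ℂ L
  exact self_eq_neg.1 h

theorem bracket_eq_neg_of_even {k : ZMod 2} {x y : L} (hx : x ∈ G.part k) (hy : y ∈ G.part 0) :
    G.bracket x y = -G.bracket y x := by
  have h := G.skew hx hy
  simpa only [superSign, ZMod.val_zero, mul_zero, pow_zero, one_smul] using h

theorem bracket_bracket {k l : ZMod 2} {x y : L} (hx : x ∈ G.part k) (hy : y ∈ G.part l) (z : L) :
    G.bracket (G.bracket x y) z =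
      G.bracket x (G.bracket y z) - superSign k l • G.bracket y (G.bracket x z) := by
  obtain ⟨z₀, h₀, z₁, h₁, rfl⟩ := G.exists_add z
  simp only [map_add, smul_add, G.jacobi hx hy h₀, G.jacobi hx hy h₁]
  abel

theorem bracket_bracket_self_of_even_of_odd {x y : L} (hx : x ∈ G.part 0) (hy : y ∈ G.part 1) :
    G.bracket x (G.bracket y y) = (2 : ℂ) • G.bracket y (G.bracket x y) := by
  have jacobi := G.jacobi hx hy hy
  have skew := G.skew (G.bracket_mem hx hy) hy
  simp only [superSign, zero_add, ZMod.val_zero, ZMod.val_one, mul_one, pow_zero, pow_one,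
    one_smul, neg_smul, neg_neg] at jacobi skew
  rw [jacobi, skew, two_smul]

theorem IsHomogeneous.bracket {x y : L} (hx : G.IsHomogeneous x) (hy : G.IsHomogeneous y) :
    G.IsHomogeneous (G.bracket x y) :=
  hx.elim fun k hk => hy.elim fun l hl => ⟨k + l, G.bracket_mem hk hl⟩

namespace Hom

variable (φ : G.Hom H) {s : Set L}

theorem idealSpan_le_ker (hs : ∀ x ∈ s, φ x = 0) :
    G.idealSpan s ≤ LinearMap.ker φ.toLinearMap := by
  refine sInf_le ⟨hs, fun x y hy => ?_⟩
  rw [LinearMap.mem_ker] at hy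
  simp only [LinearMap.mem_ker, φ.map_bracket, hy, map_zero, LinearMap.zero_apply, and_self]

variable {ι : Type*} {t : ι → L} {E : ι → M} {γ : ι → ℂ}

theorem idealSpan_eq_ker_of_span_sup_eq_top (hs : ∀ x ∈ s, φ x = 0) (hE : LinearIndependent ℂ E)
    (ht : ∀ i, φ (t i) = γ i • E i) (hγ : ∀ i, γ i = 0 → t i ∈ G.idealSpan s)
    (htop : Submodule.span ℂ (Set.range t) ⊔ G.idealSpan s = ⊤) :
    G.idealSpan s = LinearMap.ker φ.toLinearMap := by
  refine le_antisymm (φ.idealSpan_le_ker hs) fun x hx => ?_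
  obtain ⟨y, hy, z, hz, rfl⟩ := Submodule.mem_sup.1 (htop ▸ Submodule.mem_top (x := x))
  obtain ⟨c, rfl⟩ := Finsupp.mem_span_range_iff_exists_finsupp.1 hy
  have hcγ : ∀ i ∈ c.support, c i * γ i = 0 := by
    rw [LinearMap.mem_ker, map_add, φ.idealSpan_le_ker hs hz, add_zero, map_finsuppSum] at hx
    simp only [map_smul, ht, smul_smul] at hx
    exact linearIndependent_iff'.1 hE c.support _ hx
  refine add_mem (Submodule.sum_mem _ fun i hi => Submodule.smul_mem _ _ (hγ i ?_)) hz
  exact (mul_eq_zero.1 (hcγ i hi)).resolve_left (Finsupp.mem_support_iff.1 hi)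

theorem range_eq_span_of_span_sup_eq_top (hs : ∀ x ∈ s, φ x = 0)
    (ht : ∀ i, φ (t i) = γ i • E i)
    (htop : Submodule.span ℂ (Set.range t) ⊔ G.idealSpan s = ⊤) :
    LinearMap.range φ.toLinearMap = Submodule.span ℂ (E '' {i | γ i ≠ 0}) := by
  rw [LinearMap.range_eq_map, ← htop, Submodule.map_sup,
    LinearMap.le_ker_iff_map.1 (φ.idealSpan_le_ker hs), sup_bot_eq, Submodule.map_span,
    ← Set.range_comp, ← span_range_smul_eq_span_image]
  congr 2
  exact funext ht

end Hom

end LieSuperalgebra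

/-! ### Spanning the free Lie superalgebra -/

section FreeSpan

variable {X : Type*} (p : X → ZMod 2)

/-- A nonassociative word in the generators, as an iterated bracket in the free Lie
superalgebra. -/
noncomputable def freeWord (w : FreeMagma X) : FreeLieSuper p :=
  (identityIdeal p).mkQ (MonoidAlgebra.single w (1 : ℂ))

theorem freeWord_mul (v w : FreeMagma X) :
    freeWord p (v * w) = (freeLieSuperalgebra p).bracket (freeWord p v) (freeWord p w) := by
  change _ = freeBracket p _ _
  rw [freeWord, freeWord, freeWord, freeBracket_mk, MonoidAlgebra.single_mul_single, one_mul]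

theorem freeGen_mem_part (x : X) : freeGen p x ∈ (freeLieSuperalgebra p).part (p x) :=
  ⟨_, FreeNonUnitalNonAssocAlgebra.lift_of_apply ℂ _ x, rfl⟩

theorem freeWord_isHomogeneous (w : FreeMagma X) :
    (freeLieSuperalgebra p).IsHomogeneous (freeWord p w) := by
  induction w with
  | ih1 x => exact ⟨p x, freeGen_mem_part p x⟩
  | ih2 v w hv hw => exact freeWord_mul p v w ▸ hv.bracket hw

theorem span_range_freeWord : Submodule.span ℂ (Set.range (freeWord p)) = ⊤ := by
  rw [eq_top_iff]
  rintro x -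
  obtain ⟨f, rfl⟩ := Submodule.mkQ_surjective _ x
  induction f using MonoidAlgebra.induction_linear with
  | zero => exact zero_mem _
  | add f g hf hg => rw [map_add]; exact add_mem hf hg
  | single w r =>
    have hw : (MonoidAlgebra.single w r : FreeNonUnitalNonAssocAlgebra ℂ X) =
        r • MonoidAlgebra.single w (1 : ℂ) := by
      rw [MonoidAlgebra.smul_single, smul_eq_mul, mul_one]
    rw [hw, map_smul]
    exact Submodule.smul_mem _ r (Submodule.subset_span ⟨w, rfl⟩)

variable {p} {V : Submodule ℂ (FreeLieSuper p)}

theorem bracket_freeWord_mem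
    (hV : ∀ x, ∀ v ∈ V, (freeLieSuperalgebra p).bracket (freeGen p x) v ∈ V) (w : FreeMagma X) :
    ∀ v ∈ V, (freeLieSuperalgebra p).bracket (freeWord p w) v ∈ V := by
  induction w with
  | ih1 x => exact hV x
  | ih2 u w hu hw =>
    intro v hv
    obtain ⟨k, hk⟩ := freeWord_isHomogeneous p u
    obtain ⟨l, hl⟩ := freeWord_isHomogeneous p w
    rw [freeWord_mul, LieSuperalgebra.bracket_bracket hk hl]
    exact V.sub_mem (hu _ (hw _ hv)) (V.smul_mem _ (hw _ (hu _ hv)))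

theorem eq_top_of_bracket_freeGen_mem (hgen : ∀ x, freeGen p x ∈ V)
    (hV : ∀ x, ∀ v ∈ V, (freeLieSuperalgebra p).bracket (freeGen p x) v ∈ V) : V = ⊤ := by
  rw [eq_top_iff, ← span_range_freeWord p, Submodule.span_le]
  rintro _ ⟨w, rfl⟩
  induction w with
  | ih1 x => exact hgen x
  | ih2 v w _ hw => exact freeWord_mul p v w ▸ bracket_freeWord_mem hV v _ hw

theorem span_sup_idealSpan_eq_top {ι : Type*} {t : ι → FreeLieSuper p} {s : Set (FreeLieSuper p)}
    (hgen : ∀ x, freeGen p x ∈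
      Submodule.span ℂ (Set.range t) ⊔ (freeLieSuperalgebra p).idealSpan s)
    (hbracket : ∀ x i, (freeLieSuperalgebra p).bracket (freeGen p x) (t i) ∈
      Submodule.span ℂ (Set.range t) ⊔ (freeLieSuperalgebra p).idealSpan s) :
    Submodule.span ℂ (Set.range t) ⊔ (freeLieSuperalgebra p).idealSpan s = ⊤ := by
  refine eq_top_of_bracket_freeGen_mem hgen fun x =>
    sup_le (c := Submodule.comap ((freeLieSuperalgebra p).bracket (freeGen p x)) (_ ⊔ _))
      (Submodule.span_le.2 ?_) fun y hy => ?_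
  · rintro _ ⟨i, rfl⟩
    exact hbracket x i
  · exact Submodule.mem_sup_right (LieSuperalgebra.bracket_mem_idealSpan _ hy)

end FreeSpan

/-! ### Brackets of monomials in a quasi-commuting pair -/

theorem semiconjBy_pow_pow_of_smul {R A : Type*} [CommSemiring R] [Semiring A] [Algebra R A]
    {d s : A} {ζ : R} (h : SemiconjBy s d (ζ • d)) (m k : ℕ) :
    SemiconjBy (s ^ m) (d ^ k) (ζ ^ (m * k) • d ^ k) := by
  suffices SemiconjBy (s ^ m) d (ζ ^ m • d) by
    simpa only [smul_pow, ← pow_mul] using this.pow_right k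
  induction m with
  | zero => simpa only [pow_zero, one_smul] using SemiconjBy.one_left d
  | succ m ih =>
    have hs : SemiconjBy s (ζ ^ m • d) (ζ ^ (m + 1) • d) := by
      rw [pow_succ, mul_smul]
      exact h.smul_right (ζ ^ m)
    exact pow_succ' s m ▸ hs.mul_left ih

section Monomials

variable {ι : Type*} [Fintype ι] [DecidableEq ι] {p : ι → ZMod 2} {d s : Matrix ι ι ℂ} {ζ : ℂ}

theorem pow_mem_part {k : ZMod 2} {A : Matrix ι ι ℂ} (hA : A ∈ (glSuper p).part k) (m : ℕ) :
    A ^ m ∈ (glSuper p).part (m * k) := by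
  induction m with
  | zero =>
    intro i j hij
    rw [pow_zero, Matrix.one_apply_ne]
    rintro rfl
    exact hij (by rw [CharTwo.add_self_eq_zero, Nat.cast_zero, zero_mul])
  | succ m ih =>
    rw [pow_succ, Nat.cast_succ, add_mul, one_mul]
    exact matrixPart_mul ih hA

theorem pow_mul_pow_mem_part (hd : d ∈ (glSuper p).part 0) (hs : s ∈ (glSuper p).part 1)
    (k m : ℕ) : d ^ k * s ^ m ∈ (glSuper p).part m := by
  have h := matrixPart_mul (pow_mem_part hd k) (pow_mem_part hs m)
  rwa [mul_zero, zero_add, mul_one] at h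

theorem bracket_pow_mul_pow_of_even (hd : d ∈ (glSuper p).part 0) (hs : s ∈ (glSuper p).part 1)
    (h : SemiconjBy s d (ζ • d)) (k m : ℕ) :
    (glSuper p).bracket d (d ^ k * s ^ m) = (1 - ζ ^ m) • (d ^ (k + 1) * s ^ m) := by
  have hcomm : d ^ k * s ^ m * d = ζ ^ m • (d ^ (k + 1) * s ^ m) := by
    have := (semiconjBy_pow_pow_of_smul h m 1).eq
    rw [pow_one, mul_one] at this
    rw [mul_assoc, this, smul_mul_assoc, mul_smul_comm, ← mul_assoc, pow_succ]
  refine (matrixSuperbracket_apply hd (pow_mul_pow_mem_part hd hs k m)).trans ?_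
  rw [superSign, ZMod.val_zero, zero_mul, pow_zero, one_smul, hcomm, ← mul_assoc, ← pow_succ',
    sub_smul, one_smul]

theorem bracket_pow_mul_pow_of_odd (hd : d ∈ (glSuper p).part 0) (hs : s ∈ (glSuper p).part 1)
    (h : SemiconjBy s d (ζ • d)) (k m : ℕ) :
    (glSuper p).bracket s (d ^ k * s ^ m) = (ζ ^ k - (-1) ^ m) • (d ^ k * s ^ (m + 1)) := by
  have hcomm : s * (d ^ k * s ^ m) = ζ ^ k • (d ^ k * s ^ (m + 1)) := by
    have := (semiconjBy_pow_pow_of_smul h 1 k).eq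
    rw [pow_one, one_mul] at this
    rw [← mul_assoc, this, mul_assoc, ← pow_succ', smul_mul_assoc]
  refine (matrixSuperbracket_apply hs (pow_mul_pow_mem_part hd hs k m)).trans ?_
  rw [superSign, ZMod.val_one, one_mul, ZMod.val_natCast, ← neg_one_pow_eq_pow_mod_two, hcomm,
    mul_assoc, ← pow_succ, sub_smul]

end Monomials

/-! ### Clock and shift matrices -/

section ClockShift

variable {R : Type*}

/-- The clock matrix `diag(1, ζ, …, ζ^(N-1))`. -/
def clockMatrix [Semiring R] (N : ℕ) (ζ : R) : Matrix (Fin N) (Fin N) R :=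
  Matrix.diagonal fun i => ζ ^ i.val

/-- The cyclic shift matrix, with the entry `1` in the positions `(i, i + 1)` modulo `N`. -/
def shiftMatrix [Semiring R] (N : ℕ) : Matrix (Fin N) (Fin N) R :=
  Matrix.of fun i j => if j.val = (i.val + 1) % N then 1 else 0

/-- The monomials `D ^ k * S ^ m` in the clock matrix `D` and the shift matrix `S`. -/
def clockShiftMonomial [Semiring R] (N : ℕ) (ζ : R) (k m : ℕ) : Matrix (Fin N) (Fin N) R :=
  clockMatrix N ζ ^ k * shiftMatrix N ^ m

section Semiring

variable [CommSemiring R] {N : ℕ} {ζ : R}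

theorem shiftMatrix_pow_apply (m : ℕ) (i j : Fin N) :
    (shiftMatrix N ^ m : Matrix (Fin N) (Fin N) R) i j =
      if j.val = (i.val + m) % N then 1 else 0 := by
  induction m generalizing i j with
  | zero =>
    simp only [pow_zero, Matrix.one_apply, add_zero, Nat.mod_eq_of_lt i.isLt, Fin.ext_iff, eq_comm]
  | succ m ih =>
    rw [pow_succ, Matrix.mul_apply,
      Finset.sum_eq_single ⟨(i.val + m) % N, Nat.mod_lt _ i.pos⟩]
    · rw [ih, if_pos rfl, one_mul]
      simp only [shiftMatrix, Matrix.of_apply, Nat.mod_add_mod, add_assoc]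
    · intro l _ hl
      rw [ih, if_neg fun h => hl (Fin.ext h), zero_mul]
    · exact fun h => absurd (Finset.mem_univ _) h

theorem clockShiftMonomial_apply (k m : ℕ) (i j : Fin N) :
    clockShiftMonomial N ζ k m i j =
      if j.val = (i.val + m) % N then (ζ ^ i.val) ^ k else 0 := by
  rw [clockShiftMonomial, clockMatrix, Matrix.diagonal_pow, Matrix.diagonal_mul,
    shiftMatrix_pow_apply, mul_ite, mul_one, mul_zero, Pi.pow_apply]

theorem shiftMatrix_pow_self : (shiftMatrix N ^ N : Matrix (Fin N) (Fin N) R) = 1 := by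
  ext i j
  rw [shiftMatrix_pow_apply, Nat.add_mod_right, Nat.mod_eq_of_lt i.isLt, Matrix.one_apply]
  simp only [Fin.ext_iff, eq_comm]

theorem clockMatrix_pow_self (hζ : ζ ^ N = 1) : clockMatrix N ζ ^ N = 1 := by
  rw [clockMatrix, Matrix.diagonal_pow, ← Matrix.diagonal_one]
  congr 1
  ext i
  rw [Pi.pow_apply, pow_right_comm, hζ, one_pow]

theorem clockShiftMonomial_zero_zero : clockShiftMonomial N ζ 0 0 = 1 := by
  rw [clockShiftMonomial, pow_zero, pow_zero, mul_one]

theorem clockShiftMonomial_add_period_left (hζ : ζ ^ N = 1) (k m : ℕ) :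
    clockShiftMonomial N ζ (k + N) m = clockShiftMonomial N ζ k m := by
  rw [clockShiftMonomial, pow_add, clockMatrix_pow_self hζ, mul_one, clockShiftMonomial]

theorem clockShiftMonomial_add_period_right (k m : ℕ) :
    clockShiftMonomial N ζ k (m + N) = clockShiftMonomial N ζ k m := by
  rw [clockShiftMonomial, pow_add, shiftMatrix_pow_self, mul_one, clockShiftMonomial]

theorem semiconjBy_shiftMatrix_clockMatrix (hζ : ζ ^ N = 1) :
    SemiconjBy (shiftMatrix N) (clockMatrix N ζ) (ζ • clockMatrix N ζ) := by
  ext i j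
  rw [clockMatrix, Matrix.mul_diagonal, smul_mul_assoc, Matrix.smul_apply, Matrix.diagonal_mul,
    shiftMatrix, Matrix.of_apply]
  split_ifs with h
  · rw [one_mul, mul_one, h, ← pow_eq_pow_mod _ hζ, pow_succ', smul_eq_mul]
  · rw [zero_mul, mul_zero, smul_zero]

end Semiring

variable {N : ℕ} {ζ : R}

theorem linearIndependent_clockShiftMonomial [CommRing R] [IsDomain R]
    (hζ : IsPrimitiveRoot ζ N) (a b : ℕ) :
    LinearIndependent R fun x : Fin N × Fin N =>
      clockShiftMonomial N ζ (x.1 + a) (x.2 + b) := by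
  rw [Fintype.linearIndependent_iff]
  intro c hc
  suffices ∀ m, (fun k => c (k, m)) = 0 from fun x => congrFun (this x.2) x.1
  intro m
  apply Matrix.eq_zero_of_forall_index_sum_mul_pow_eq_zero (f := fun i : Fin N => ζ ^ i.val)
  · exact fun i j h => Fin.ext (hζ.pow_inj i.isLt j.isLt h)
  intro i
  have hN : N ≠ 0 := i.pos.ne'
  have hentry (x : Fin N × Fin N) :
      clockShiftMonomial N ζ (x.1 + a) (x.2 + b) i
        ⟨(i.val + (m + b)) % N, Nat.mod_lt _ i.pos⟩ =
      if x.2 = m then (ζ ^ i.val) ^ (x.1 + a : ℕ) else 0 := by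
    rw [clockShiftMonomial_apply]
    refine if_congr ⟨fun h => ?_, fun h => by rw [h]⟩ rfl rfl
    have h' : i.val + b + m ≡ i.val + b + x.2 [MOD N] := by
      simpa only [Nat.ModEq, add_assoc, add_comm b] using h
    exact Fin.ext (Nat.ModEq.eq_of_lt_of_lt (h'.add_left_cancel' _) m.isLt x.2.isLt).symm
  have hsum := congrFun (congrFun hc i) ⟨(i.val + (m + b)) % N, Nat.mod_lt _ i.pos⟩
  simp only [Matrix.sum_apply, Matrix.smul_apply, hentry, smul_eq_mul, mul_ite, mul_zero,
    Fintype.sum_prod_type, Finset.sum_ite_eq', Finset.mem_univ, if_true, Matrix.zero_apply, pow_add,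
    ← mul_assoc, ← Finset.sum_mul] at hsum
  exact (mul_eq_zero.1 hsum).resolve_right (pow_ne_zero _ (pow_ne_zero _ (hζ.ne_zero hN)))

theorem clockShiftMonomial_ne_zero [CommRing R] [IsDomain R] (hζ : IsPrimitiveRoot ζ N)
    (hN : N ≠ 0) (k m : ℕ) : clockShiftMonomial N ζ k m ≠ 0 := by
  have : NeZero N := ⟨hN⟩
  simpa only [Fin.val_zero, zero_add] using
    (linearIndependent_clockShiftMonomial hζ k m).ne_zero (0, 0)

theorem span_clockShiftMonomial [Field R] (hζ : IsPrimitiveRoot ζ N) (a b : ℕ) :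
    Submodule.span R (Set.range fun x : Fin N × Fin N =>
      clockShiftMonomial N ζ (x.1 + a) (x.2 + b)) = ⊤ :=
  (linearIndependent_clockShiftMonomial hζ a b).span_eq_top_of_card_eq_finrank' (by
    rw [Module.finrank_matrix, Module.finrank_self, mul_one, Fintype.card_prod])

end ClockShift

/-! ### Roots of unity and supertraces -/

section RootsOfUnity

variable {R : Type*} [CommRing R] {ζ : R} {N : ℕ}

theorem one_sub_pow_eq_zero_iff (hζ : IsPrimitiveRoot ζ N) (m : ℕ) : 1 - ζ ^ m = 0 ↔ N ∣ m := by
  rw [sub_eq_zero, eq_comm, hζ.pow_eq_one_iff_dvd]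

theorem sub_neg_one_pow_ne_zero (hζ : IsPrimitiveRoot ζ N) (hN : ¬N ∣ 2) (j : ℕ) :
    ζ - (-1) ^ j ≠ 0 := by
  intro h
  apply hN
  rw [← hζ.pow_eq_one_iff_dvd, sub_eq_zero.1 h, pow_right_comm, neg_one_sq, one_pow]

variable [IsDomain R]

theorem pow_half_eq_neg_one {n : ℕ} (hζ : IsPrimitiveRoot ζ (2 * n)) (hn : n ≠ 0) : ζ ^ n = -1 :=
  (hζ.pow (by positivity) (mul_comm 2 n)).eq_neg_one_of_two_right

theorem pow_add_one_eq_zero_iff {n : ℕ} (hζ : IsPrimitiveRoot ζ (2 * n)) (hn : n ≠ 0) (k : ℕ) :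
    ζ ^ k + 1 = 0 ↔ 2 * n ∣ k + n := by
  rw [← hζ.pow_eq_one_iff_dvd, pow_add, pow_half_eq_neg_one hζ hn, mul_neg_one, neg_eq_iff_eq_neg,
    eq_neg_iff_add_eq_zero]

theorem geom_sum_pow_eq_ite (hζ : IsPrimitiveRoot ζ N) (l : ℕ) :
    ∑ i ∈ Finset.range N, (ζ ^ l) ^ i = if N ∣ l then (N : R) else 0 := by
  split_ifs with h
  · simp only [(hζ.pow_eq_one_iff_dvd l).2 h, one_pow, Finset.sum_const, Finset.card_range,
      nsmul_one]
  · have hne : 1 - ζ ^ l ≠ 0 := (one_sub_pow_eq_zero_iff hζ l).not.2 h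
    have hsum := mul_neg_geom_sum (ζ ^ l) N
    rw [pow_right_comm, hζ.pow_eq_one, one_pow, sub_self] at hsum
    exact (mul_eq_zero.1 hsum).resolve_left hne

end RootsOfUnity

theorem supertrace_clockShiftMonomial {n : ℕ} {ζ : ℂ} (hζ : IsPrimitiveRoot ζ (2 * n))
    (hn : n ≠ 0) (k m : ℕ) :
    supertrace (alternating n) (clockShiftMonomial (2 * n) ζ k m) =
      if 2 * n ∣ m ∧ 2 * n ∣ k + n then ((2 * n : ℕ) : ℂ) else 0 := by
  have hterm (i : Fin (2 * n)) :
      (-1 : ℂ) ^ (alternating n i).val * clockShiftMonomial (2 * n) ζ k m i i =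
        if 2 * n ∣ m then (ζ ^ (k + n)) ^ i.val else 0 := by
    have hdiag : i.val = (i.val + m) % (2 * n) ↔ 2 * n ∣ m := by
      rw [← Nat.add_modEq_left_iff (a := i.val), Nat.ModEq, Nat.mod_eq_of_lt i.isLt, eq_comm]
    rw [alternating, ZMod.val_natCast, ← neg_one_pow_eq_pow_mod_two,
      ← pow_half_eq_neg_one hζ hn,
      clockShiftMonomial_apply, mul_ite, mul_zero]
    exact if_congr hdiag (by ring) rfl
  change ∑ i, (-1 : ℂ) ^ (alternating n i).val * _ = _
  simp only [hterm, ite_and, Fin.sum_univ_eq_sum_range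
    (fun i => if 2 * n ∣ m then (ζ ^ (k + n)) ^ i else 0), ← geom_sum_pow_eq_ite hζ]
  split_ifs
  · rfl
  · exact Finset.sum_const_zero

/-! ### Words in the generators and their values -/

theorem genD_mem_part : genD ∈ (freeLieSuperalgebra sylvesterParity).part 0 :=
  freeGen_mem_part sylvesterParity .D

theorem genS_mem_part : genS ∈ (freeLieSuperalgebra sylvesterParity).part 1 :=
  freeGen_mem_part sylvesterParity .S

section Parity

variable {k : ZMod 2} {x : FreeSylvester}

theorem adD_mem_part (hx : x ∈ (freeLieSuperalgebra sylvesterParity).part k) :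
    adD x ∈ (freeLieSuperalgebra sylvesterParity).part k :=
  zero_add k ▸ (freeLieSuperalgebra sylvesterParity).bracket_mem genD_mem_part hx

theorem adS_mem_part (hx : x ∈ (freeLieSuperalgebra sylvesterParity).part k) :
    adS x ∈ (freeLieSuperalgebra sylvesterParity).part (k + 1) :=
  add_comm 1 k ▸ (freeLieSuperalgebra sylvesterParity).bracket_mem genS_mem_part hx

theorem adD_pow_mem_part (hx : x ∈ (freeLieSuperalgebra sylvesterParity).part k) (j : ℕ) :
    (adD ^ j) x ∈ (freeLieSuperalgebra sylvesterParity).part k := by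
  induction j with
  | zero => exact hx
  | succ j ih => exact pow_succ' adD j ▸ adD_mem_part ih

theorem adS_pow_mem_part (hx : x ∈ (freeLieSuperalgebra sylvesterParity).part k) (j : ℕ) :
    (adS ^ j) x ∈ (freeLieSuperalgebra sylvesterParity).part (k + j) := by
  induction j with
  | zero => simpa only [pow_zero, Module.End.one_apply, Nat.cast_zero, add_zero] using hx
  | succ j ih =>
    rw [pow_succ', Nat.cast_succ, ← add_assoc]
    exact adS_mem_part ih

end Parity

theorem adD_genD : adD genD = 0 :=
  LieSuperalgebra.bracket_self_of_even genD_mem_part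

theorem adS_genD : adS genD = -adD genS :=
  LieSuperalgebra.bracket_eq_neg_of_even genS_mem_part genD_mem_part

theorem adD_adS_genS : adD (adS genS) = (2 : ℂ) • adS (adD genS) :=
  LieSuperalgebra.bracket_bracket_self_of_even_of_odd genD_mem_part genS_mem_part

theorem adS_genS_mem_part : adS genS ∈ (freeLieSuperalgebra sylvesterParity).part 0 :=
  CharTwo.add_self_eq_zero (1 : ZMod 2) ▸ adS_mem_part genS_mem_part

/-- The primitive `2n`-th root of unity `a = exp(2πi/(2n))`. -/
noncomputable def sylvesterRoot (n : ℕ) : ℂ :=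
  Complex.exp (2 * Real.pi * Complex.I / ((2 * n : ℕ) : ℂ))

theorem isPrimitiveRoot_sylvesterRoot {n : ℕ} (hn : n ≠ 0) :
    IsPrimitiveRoot (sylvesterRoot n) (2 * n) :=
  Complex.isPrimitiveRoot_exp (2 * n) (by positivity)

theorem sylvesterRoot_pow_two_mul (n : ℕ) : sylvesterRoot n ^ (2 * n) = 1 := by
  rcases eq_or_ne n 0 with rfl | hn
  · exact pow_zero _
  · exact (isPrimitiveRoot_sylvesterRoot hn).pow_eq_one

section Evaluation

variable {n : ℕ}

theorem sylvesterEval_genD :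
    sylvesterEval n genD = (1 : ℂ) • clockShiftMonomial (2 * n) (sylvesterRoot n) 1 0 := by
  rw [one_smul, clockShiftMonomial, pow_one, pow_zero, mul_one]
  exact LieSuperalgebra.lift_freeGen _ _ _ _ _

theorem sylvesterEval_genS :
    sylvesterEval n genS = (1 : ℂ) • clockShiftMonomial (2 * n) (sylvesterRoot n) 0 1 := by
  rw [one_smul, clockShiftMonomial, pow_one, pow_zero, one_mul]
  exact LieSuperalgebra.lift_freeGen _ _ _ _ _

variable {x : FreeSylvester} {r : ℂ} {k m : ℕ}

theorem sylvesterEval_adD_of_eq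
    (hx : sylvesterEval n x = r • clockShiftMonomial (2 * n) (sylvesterRoot n) k m) :
    sylvesterEval n (adD x) = (r * (1 - sylvesterRoot n ^ m)) •
      clockShiftMonomial (2 * n) (sylvesterRoot n) (k + 1) m := by
  rw [adD, (sylvesterEval n).map_bracket, hx, map_smul, mul_smul, genD, sylvesterEval,
    LieSuperalgebra.lift_freeGen]
  exact congrArg (r • ·) (bracket_pow_mul_pow_of_even (sylvesterMatrix_mem n .D)
    (sylvesterMatrix_mem n .S)
    (semiconjBy_shiftMatrix_clockMatrix (sylvesterRoot_pow_two_mul n)) k m)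

theorem sylvesterEval_adS_of_eq
    (hx : sylvesterEval n x = r • clockShiftMonomial (2 * n) (sylvesterRoot n) k m) :
    sylvesterEval n (adS x) = (r * (sylvesterRoot n ^ k - (-1) ^ m)) •
      clockShiftMonomial (2 * n) (sylvesterRoot n) k (m + 1) := by
  rw [adS, (sylvesterEval n).map_bracket, hx, map_smul, mul_smul, genS, sylvesterEval,
    LieSuperalgebra.lift_freeGen]
  exact congrArg (r • ·) (bracket_pow_mul_pow_of_odd (sylvesterMatrix_mem n .D)
    (sylvesterMatrix_mem n .S)
    (semiconjBy_shiftMatrix_clockMatrix (sylvesterRoot_pow_two_mul n)) k m)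

theorem sylvesterEval_adD_pow_of_eq
    (hx : sylvesterEval n x = r • clockShiftMonomial (2 * n) (sylvesterRoot n) k m) (j : ℕ) :
    sylvesterEval n ((adD ^ j) x) = (r * (1 - sylvesterRoot n ^ m) ^ j) •
      clockShiftMonomial (2 * n) (sylvesterRoot n) (k + j) m := by
  induction j with
  | zero => simpa only [pow_zero, Module.End.one_apply, mul_one, add_zero] using hx
  | succ j ih =>
    rw [pow_succ', Module.End.mul_apply, sylvesterEval_adD_of_eq ih, pow_succ, ← mul_assoc,
      add_assoc]

theorem sylvesterEval_adD_pow_sub_smul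
    (hx : sylvesterEval n x = r • clockShiftMonomial (2 * n) (sylvesterRoot n) k m) :
    sylvesterEval n ((adD ^ (2 * n)) x - (1 - sylvesterRoot n ^ m) ^ (2 * n) • x) = 0 := by
  rw [map_sub, map_smul, sylvesterEval_adD_pow_of_eq hx, hx,
    clockShiftMonomial_add_period_left (sylvesterRoot_pow_two_mul n), smul_smul, mul_comm r,
    sub_self]

end Evaluation

theorem sylvesterEval_adD_adS_adD_genS (n : ℕ) :
    sylvesterEval n (adD (adS (adD genS))) = ((1 - sylvesterRoot n ^ 2) ^ 2) •
      clockShiftMonomial (2 * n) (sylvesterRoot n) 2 2 := by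
  rw [sylvesterEval_adD_of_eq (sylvesterEval_adS_of_eq
    (sylvesterEval_adD_of_eq sylvesterEval_genS))]
  congr 1
  ring

theorem sylvesterEval_adS_adD_adD_genS (n : ℕ) :
    sylvesterEval n (adS (adD (adD genS))) =
      ((1 - sylvesterRoot n) ^ 2 * (sylvesterRoot n ^ 2 + 1)) •
        clockShiftMonomial (2 * n) (sylvesterRoot n) 2 2 := by
  rw [sylvesterEval_adS_of_eq (sylvesterEval_adD_of_eq
    (sylvesterEval_adD_of_eq sylvesterEval_genS))]
  congr 1
  ring

theorem sylvesterRoot_one : sylvesterRoot 1 = -1 := by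
  simpa only [pow_one] using pow_half_eq_neg_one (isPrimitiveRoot_sylvesterRoot one_ne_zero)
    one_ne_zero

/- The first path evaluates to zero for `n = 1`, the second one for `n = 2`. -/
theorem linearIndependent_paths_to_two_two :
    LinearIndependent ℂ ![adD (adS (adD genS)), adS (adD (adD genS))] := by
  rw [LinearIndependent.pair_iff]
  intro x y hxy
  have heval (n : ℕ) (hn : n ≠ 0) : x * (1 - sylvesterRoot n ^ 2) ^ 2 +
      y * ((1 - sylvesterRoot n) ^ 2 * (sylvesterRoot n ^ 2 + 1)) = 0 := by
    have h := congrArg (sylvesterEval n) hxy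
    rw [map_add, map_smul, map_smul, map_zero, sylvesterEval_adD_adS_adD_genS,
      sylvesterEval_adS_adD_adD_genS, smul_smul, smul_smul, ← add_smul] at h
    exact (smul_eq_zero.1 h).resolve_right
      (clockShiftMonomial_ne_zero (isPrimitiveRoot_sylvesterRoot hn) (by positivity) 2 2)
  have h1 := heval 1 one_ne_zero
  have h2 := heval 2 two_ne_zero
  rw [sylvesterRoot_one] at h1
  rw [pow_half_eq_neg_one (isPrimitiveRoot_sylvesterRoot two_ne_zero) two_ne_zero] at h2
  constructor
  · linear_combination h2 / 4
  · linear_combination h1 / 8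

/-! ### The grid of the elements `T_m^k` -/

section Grid

variable {n m k : ℕ}

theorem gridT_of_lt (hm : m < 2 * n) (k : ℕ) :
    gridT n m k = (adD ^ (k - 1)) ((adS ^ (m - 1)) (adD genS)) := by
  rw [gridT, if_neg hm.ne]

theorem gridT_one_one (hn : n ≠ 0) : gridT n 1 1 = adD genS :=
  gridT_of_lt (by lia) 1

theorem adS_gridT_penultimate (hn : n ≠ 0) (k : ℕ) :
    adS (gridT n (2 * n - 1) k) = gridT n (2 * n) k := by
  rw [gridT_of_lt (by lia), gridT, if_pos rfl, Nat.sub_sub]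

theorem adS_gridT_one (hm : 1 ≤ m) (hm' : m + 1 < 2 * n) :
    adS (gridT n m 1) = gridT n (m + 1) 1 := by
  rw [gridT_of_lt (by lia), gridT_of_lt hm', Nat.sub_add_comm hm, pow_succ' adS]
  rfl

theorem adD_pow_gridT (hm : m < 2 * n) (j : ℕ) (hk : 1 ≤ k) :
    (adD ^ j) (gridT n m k) = gridT n m (k + j) := by
  rw [gridT_of_lt hm, gridT_of_lt hm, ← Module.End.mul_apply, ← pow_add, Nat.sub_add_comm hk,
    add_comm]

theorem adD_gridT (hm : m < 2 * n) (hk : 1 ≤ k) : adD (gridT n m k) = gridT n m (k + 1) :=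
  pow_one adD ▸ adD_pow_gridT hm 1 hk

theorem adD_pow_genS (hn : n ≠ 0) : (adD ^ (2 * n)) genS = gridT n 1 (2 * n) := by
  rw [gridT_of_lt (by lia), ← Nat.sub_add_cancel (show 1 ≤ 2 * n by lia), pow_succ]
  rfl

theorem gridT_mem_part (hm : 1 ≤ m) (hm' : m ≤ 2 * n) (k : ℕ) :
    gridT n m k ∈ (freeLieSuperalgebra sylvesterParity).part m := by
  have row {j : ℕ} (hj : j + 1 < 2 * n) :
      gridT n (j + 1) k ∈ (freeLieSuperalgebra sylvesterParity).part (j + 1 : ℕ) := by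
    rw [gridT_of_lt hj, Nat.cast_succ, add_comm]
    exact adD_pow_mem_part (adS_pow_mem_part (adD_mem_part genS_mem_part) j) _
  rcases hm'.lt_or_eq with h | rfl
  · exact Nat.sub_add_cancel hm ▸ row (j := m - 1) (by lia)
  · have h := adS_mem_part (row (j := 2 * n - 2) (by lia))
    rwa [← Nat.cast_succ, show 2 * n - 2 + 1 = 2 * n - 1 by lia,
      adS_gridT_penultimate (by lia), Nat.succ_eq_add_one, Nat.sub_add_cancel hm] at h

theorem gridT_mem_part_zero (hm : 1 ≤ m) (hm' : m ≤ 2 * n) (heven : 2 ∣ m) (k : ℕ) :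
    gridT n m k ∈ (freeLieSuperalgebra sylvesterParity).part 0 :=
  (ZMod.natCast_eq_zero_iff m 2).2 heven ▸ gridT_mem_part hm hm' k

/-- The coefficient of `D * S ^ (m + 1)` in the value of `(ad S)^m [D, S]` at Sylvester's
matrices. -/
noncomputable def columnCoeff (n m : ℕ) : ℂ :=
  (1 - sylvesterRoot n) * ∏ i ∈ Finset.range m, (sylvesterRoot n - (-1) ^ (i + 1))

/-- The coefficient of `D ^ k * S ^ m` in the value of `T_m^k` at Sylvester's matrices. -/
noncomputable def gridCoeff (n m k : ℕ) : ℂ :=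
  if m = 2 * n then
    columnCoeff n (m - 2) * (1 - sylvesterRoot n ^ (m - 1)) ^ (k - 1) * (sylvesterRoot n ^ k + 1)
  else columnCoeff n (m - 1) * (1 - sylvesterRoot n ^ m) ^ (k - 1)

theorem sylvesterEval_adS_pow (n m : ℕ) :
    sylvesterEval n ((adS ^ m) (adD genS)) =
      columnCoeff n m • clockShiftMonomial (2 * n) (sylvesterRoot n) 1 (m + 1) := by
  induction m with
  | zero =>
    simpa only [columnCoeff, Finset.prod_range_zero, pow_zero, pow_one, Module.End.one_apply,
      one_mul, mul_one, zero_add] using sylvesterEval_adD_of_eq (n := n) sylvesterEval_genS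
  | succ m ih =>
    rw [pow_succ', Module.End.mul_apply, sylvesterEval_adS_of_eq ih, columnCoeff, columnCoeff,
      Finset.prod_range_succ, pow_one, mul_assoc]

theorem sylvesterEval_gridT (hm : 1 ≤ m) (hm' : m ≤ 2 * n) (hk : 1 ≤ k) :
    sylvesterEval n (gridT n m k) =
      gridCoeff n m k • clockShiftMonomial (2 * n) (sylvesterRoot n) k m := by
  have row {j : ℕ} (hj : j + 1 < 2 * n) : sylvesterEval n (gridT n (j + 1) k) =
      (columnCoeff n j * (1 - sylvesterRoot n ^ (j + 1)) ^ (k - 1)) •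
        clockShiftMonomial (2 * n) (sylvesterRoot n) k (j + 1) := by
    rw [gridT_of_lt hj, Nat.add_sub_cancel,
      sylvesterEval_adD_pow_of_eq (sylvesterEval_adS_pow n j), Nat.add_sub_cancel' hk]
  rcases hm'.lt_or_eq with h | rfl
  · have := row (j := m - 1) (by lia)
    rw [gridCoeff, if_neg h.ne]
    rwa [Nat.sub_add_cancel hm] at this
  · have := sylvesterEval_adS_of_eq (row (j := 2 * n - 2) (by lia))
    rw [gridCoeff, if_pos rfl]
    rwa [show 2 * n - 2 + 1 = 2 * n - 1 by lia, Nat.sub_add_cancel hm,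
      Odd.neg_one_pow ⟨n - 1, by lia⟩, sub_neg_eq_add, adS_gridT_penultimate (by lia)] at this

theorem columnCoeff_ne_zero (hn : 1 < n) (m : ℕ) : columnCoeff n m ≠ 0 := by
  have hroot := isPrimitiveRoot_sylvesterRoot (show n ≠ 0 by lia)
  refine mul_ne_zero ?_ (Finset.prod_ne_zero_iff.2 fun i _ => sub_neg_one_pow_ne_zero hroot
    (Nat.not_dvd_of_pos_of_lt two_pos (by lia)) _)
  exact sub_ne_zero.2 (hroot.ne_one (by lia)).symm

theorem one_sub_sylvesterRoot_pow_ne_zero (hm : 1 ≤ m) (hm' : m < 2 * n) :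
    1 - sylvesterRoot n ^ m ≠ 0 :=
  (one_sub_pow_eq_zero_iff (isPrimitiveRoot_sylvesterRoot (by lia)) m).not.2
    (Nat.not_dvd_of_pos_of_lt hm hm')

theorem gridCoeff_ne_zero_of_lt (hn : 1 < n) (hm : 1 ≤ m) (hm' : m < 2 * n) (k : ℕ) :
    gridCoeff n m k ≠ 0 := by
  rw [gridCoeff, if_neg hm'.ne]
  exact mul_ne_zero (columnCoeff_ne_zero hn _)
    (pow_ne_zero _ (one_sub_sylvesterRoot_pow_ne_zero hm hm'))

theorem gridCoeff_two_mul_eq_zero_iff (hn : 1 < n) :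
    gridCoeff n (2 * n) k = 0 ↔ 2 * n ∣ k + n := by
  rw [gridCoeff, if_pos rfl, mul_eq_zero, or_iff_right (mul_ne_zero (columnCoeff_ne_zero hn _)
    (pow_ne_zero _ (one_sub_sylvesterRoot_pow_ne_zero (by lia) (by lia))))]
  exact pow_add_one_eq_zero_iff (isPrimitiveRoot_sylvesterRoot (by lia)) (by lia) k

theorem two_mul_dvd_add_iff (hk : 1 ≤ k) (hk' : k ≤ 2 * n) : 2 * n ∣ k + n ↔ k = n := by
  refine ⟨fun ⟨c, hc⟩ => ?_, fun h => ⟨1, by lia⟩⟩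
  obtain _ | _ | c := c
  · lia
  · lia
  · nlinarith

theorem gridCoeff_eq_zero_iff (hn : 1 < n) (hm : 1 ≤ m) (hm' : m ≤ 2 * n) (hk : 1 ≤ k)
    (hk' : k ≤ 2 * n) : gridCoeff n m k = 0 ↔ m = 2 * n ∧ k = n := by
  rcases hm'.lt_or_eq with h | rfl
  · simp only [gridCoeff_ne_zero_of_lt hn hm h, h.ne, false_and]
  · rw [gridCoeff_two_mul_eq_zero_iff hn, two_mul_dvd_add_iff hk hk', and_iff_right rfl]

/-- The coefficient `c_{m,k}` in `[S, T_m^k] = c_{m,k} T_{m+1}^k`, where `T_1^k` takes the place of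
`T_{2n+1}^k`. For `m = 2n - 1` it is used only at `k = 1`, in `[S, T_{2n-1}^1] = c_{2n-1,1} D`. -/
noncomputable def stepCoeff (n m k : ℕ) : ℂ :=
  if m = 2 * n - 1 then gridCoeff n (2 * n) k
  else gridCoeff n m k * (sylvesterRoot n ^ k - (-1) ^ m) / gridCoeff n (m % (2 * n) + 1) k

theorem sylvesterEval_adS_gridT_sub_smul (hn : 1 < n) (hm : 1 ≤ m) (hm' : m + 2 ≤ 2 * n)
    (hk : 1 ≤ k) :
    sylvesterEval n (adS (gridT n m k) - stepCoeff n m k • gridT n (m + 1) k) = 0 := by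
  rw [stepCoeff, if_neg (by lia), Nat.mod_eq_of_lt (by lia)]
  exact map_sub_div_smul_eq_zero
    (sylvesterEval_adS_of_eq (sylvesterEval_gridT hm (by lia) hk))
    (sylvesterEval_gridT (by lia) (by lia) hk) (gridCoeff_ne_zero_of_lt hn (by lia) (by lia) k)

theorem sylvesterEval_adS_gridT_two_mul_sub_smul (hn : 1 < n) (hk : 1 ≤ k) :
    sylvesterEval n (adS (gridT n (2 * n) k) - stepCoeff n (2 * n) k • gridT n 1 k) = 0 := by
  have hvalue := sylvesterEval_adS_of_eq (sylvesterEval_gridT (n := n) (by lia) le_rfl hk)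
  rw [add_comm (2 * n) 1, clockShiftMonomial_add_period_right] at hvalue
  rw [stepCoeff, if_neg (by lia), Nat.mod_self]
  exact map_sub_div_smul_eq_zero hvalue (sylvesterEval_gridT le_rfl (by lia) hk)
    (gridCoeff_ne_zero_of_lt hn le_rfl (by lia) k)

theorem sylvesterEval_adS_gridT_penultimate_sub_smul (hn : n ≠ 0) :
    sylvesterEval n
      (adS (gridT n (2 * n - 1) 1) - stepCoeff n (2 * n - 1) 1 • genD) = 0 := by
  rw [adS_gridT_penultimate hn, stepCoeff, if_pos rfl, map_sub, map_smul,
    sylvesterEval_gridT (by lia) le_rfl le_rfl, sylvesterEval_genD, one_smul,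
    ← clockShiftMonomial_add_period_right 1 0, zero_add, sub_self]

theorem sylvesterEval_adD_gridT_two_mul (hn : n ≠ 0) (hk : 1 ≤ k) :
    sylvesterEval n (adD (gridT n (2 * n) k)) = 0 := by
  rw [sylvesterEval_adD_of_eq (sylvesterEval_gridT (by lia) le_rfl hk),
    sylvesterRoot_pow_two_mul, sub_self, mul_zero, zero_smul]

theorem sylvesterEval_adS_gridT_two_mul_two_mul (hn : n ≠ 0) :
    sylvesterEval n (adS (gridT n (2 * n) (2 * n))) = 0 := by
  rw [sylvesterEval_adS_of_eq (sylvesterEval_gridT (by lia) le_rfl (by lia)),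
    sylvesterRoot_pow_two_mul, Even.neg_one_pow (even_two_mul n), sub_self, mul_zero, zero_smul]

theorem sylvesterEval_gridT_two_mul_self (hn : 1 < n) :
    sylvesterEval n (gridT n (2 * n) n) = 0 := by
  rw [sylvesterEval_gridT (by lia) le_rfl hn.le,
    (gridCoeff_two_mul_eq_zero_iff hn).2 (by rw [two_mul]), zero_smul]

theorem sylvesterEval_gridT_two_mul_two_mul (hn : n ≠ 0) :
    sylvesterEval n (gridT n (2 * n) (2 * n)) = gridCoeff n (2 * n) (2 * n) • 1 := by
  rw [sylvesterEval_gridT (by lia) le_rfl (by lia),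
    ← clockShiftMonomial_zero_zero (ζ := sylvesterRoot n),
    ← clockShiftMonomial_add_period_left (sylvesterRoot_pow_two_mul n) 0 0, zero_add,
    ← clockShiftMonomial_add_period_right (2 * n) 0, zero_add]

theorem sylvesterEval_adS_genS_sub_smul (hn : 1 < n) :
    sylvesterEval n (adS genS - (2 / gridCoeff n 2 (2 * n)) • gridT n 2 (2 * n)) = 0 := by
  have hvalue := sylvesterEval_adS_of_eq (n := n) sylvesterEval_genS
  rw [← clockShiftMonomial_add_period_left (sylvesterRoot_pow_two_mul n), zero_add, pow_zero,
    pow_one, one_mul, sub_neg_eq_add, one_add_one_eq_two] at hvalue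
  exact map_sub_div_smul_eq_zero hvalue (sylvesterEval_gridT (by lia) (by lia) (by lia))
    (gridCoeff_ne_zero_of_lt hn (by lia) (by lia) _)

end Grid

/-! ### The relations between the elements of the grid -/

section GridRelations

variable {n : ℕ} {b : ℕ → ℂ} {c : ℕ → ℕ → ℂ} {d : ℂ}

/-- The relations for `n > 1`, with given coefficients. -/
noncomputable def gridRelations (n : ℕ) (b : ℕ → ℂ) (c : ℕ → ℕ → ℂ) (d : ℂ) : Set FreeSylvester :=
  relationsGrid n b c d ∪ relationsIdentity n ∪ {relationTwoTwo n (c 1 2)}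

/-- The elements of `gridRelations n b c d`, one constructor for each family of relations. -/
inductive IsGridRelation (n : ℕ) (b : ℕ → ℂ) (c : ℕ → ℕ → ℂ) (d : ℂ) : FreeSylvester → Prop
  | adD_pow_genS : IsGridRelation n b c d ((adD ^ (2 * n)) genS - b 1 • genS)
  | adS_gridT_penultimate :
      IsGridRelation n b c d (adS (gridT n (2 * n - 1) 1) - c (2 * n - 1) 1 • genD)
  | adD_pow_gridT {m : ℕ} (hm : 3 ≤ m) (hm' : m ≤ 2 * n - 1) :
      IsGridRelation n b c d ((adD ^ (2 * n)) (gridT n m 1) - b m • gridT n m 1)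
  | gridT_two_mul_self : IsGridRelation n b c d (gridT n (2 * n) n)
  | adD_gridT_two_mul {k : ℕ} (hk : 2 ≤ k) (hk' : k ≤ 2 * n - 1) (hkn : k ≠ n) :
      IsGridRelation n b c d (adD (gridT n (2 * n) k))
  | adS_gridT_two_mul {k : ℕ} (hk : 2 ≤ k) (hk' : k ≤ 2 * n - 1) (hkn : k ≠ n) :
      IsGridRelation n b c d (adS (gridT n (2 * n) k) - c (2 * n) k • gridT n 1 k)
  | adS_gridT_one {k : ℕ} (hk : 3 ≤ k) (hk' : k ≤ 2 * n - 1) :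
      IsGridRelation n b c d (adS (gridT n 1 k) - c 1 k • gridT n 2 k)
  | adS_gridT {m k : ℕ} (hm : 2 ≤ m) (hm' : m + 2 ≤ 2 * n) (hk : 2 ≤ k) (hk' : k ≤ 2 * n) :
      IsGridRelation n b c d (adS (gridT n m k) - c m k • gridT n (m + 1) k)
  | adS_genS : IsGridRelation n b c d (adS genS - d • gridT n 2 (2 * n))
  | adD_gridT_two_mul_two_mul : IsGridRelation n b c d (adD (gridT n (2 * n) (2 * n)))
  | adS_gridT_two_mul_two_mul : IsGridRelation n b c d (adS (gridT n (2 * n) (2 * n)))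
  | adS_gridT_one_two : IsGridRelation n b c d (adS (gridT n 1 2) - c 1 2 • gridT n 2 2)

theorem mem_gridRelations {x : FreeSylvester} :
    x ∈ gridRelations n b c d ↔ IsGridRelation n b c d x := by
  constructor
  · rintro ((((((((((rfl | rfl) | ⟨m, hm, hm', rfl⟩) | rfl) | ⟨k, hk, hk', hkn, rfl⟩) |
      ⟨k, hk, hk', hkn, rfl⟩) | ⟨k, hk, hk', rfl⟩) | ⟨m, k, hm, hm', hk, hk', rfl⟩) | rfl) |
      (rfl | rfl)) | rfl)
    exacts [.adD_pow_genS, .adS_gridT_penultimate, .adD_pow_gridT hm hm', .gridT_two_mul_self,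
      .adD_gridT_two_mul hk hk' hkn, .adS_gridT_two_mul hk hk' hkn, .adS_gridT_one hk hk',
      .adS_gridT hm hm' hk hk', .adS_genS, .adD_gridT_two_mul_two_mul, .adS_gridT_two_mul_two_mul,
      .adS_gridT_one_two]
  · intro h
    simp only [gridRelations, relationsGrid, relationsIdentity, relationTwoTwo, Set.mem_union,
      Set.mem_insert_iff, Set.mem_singleton_iff, Set.mem_ofPred_eq]
    cases h <;> grind

theorem isHomogeneous_adS_gridT_sub_smul {m m' : ℕ} (hm : 1 ≤ m ∧ m ≤ 2 * n)
    (hm' : 1 ≤ m' ∧ m' ≤ 2 * n) (hparity : m + 1 ≡ m' [MOD 2]) (k : ℕ) (r : ℂ) :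
    (freeLieSuperalgebra sylvesterParity).IsHomogeneous
      (adS (gridT n m k) - r • gridT n m' k) := by
  refine ⟨m', sub_mem ?_ (Submodule.smul_mem _ r (gridT_mem_part hm'.1 hm'.2 k))⟩
  rw [← (ZMod.natCast_eq_natCast_iff _ _ _).2 hparity, Nat.cast_succ]
  exact adS_mem_part (gridT_mem_part hm.1 hm.2 k)

theorem isHomogeneous_of_mem_gridRelations (hn : 1 < n) :
    ∀ x ∈ gridRelations n b c d, (freeLieSuperalgebra sylvesterParity).IsHomogeneous x := by
  intro x hx
  have heven (k : ℕ) := gridT_mem_part_zero (n := n) (by lia) le_rfl (dvd_mul_right 2 n) k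
  have hodd : 2 * n + 1 ≡ 1 [MOD 2] := by simp [Nat.ModEq]
  cases mem_gridRelations.1 hx with
  | adD_pow_genS =>
    exact ⟨1, sub_mem (adD_pow_mem_part genS_mem_part _) (Submodule.smul_mem _ _ genS_mem_part)⟩
  | adS_gridT_penultimate =>
    rw [adS_gridT_penultimate (by lia)]
    exact ⟨0, sub_mem (heven 1) (Submodule.smul_mem _ _ genD_mem_part)⟩
  | @adD_pow_gridT m hm hm' =>
    have h := gridT_mem_part (n := n) (m := m) (by lia) (by lia) 1
    exact ⟨m, sub_mem (adD_pow_mem_part h _) (Submodule.smul_mem _ _ h)⟩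
  | gridT_two_mul_self => exact ⟨0, heven n⟩
  | adD_gridT_two_mul => exact ⟨0, adD_mem_part (heven _)⟩
  | adS_gridT_two_mul =>
    exact isHomogeneous_adS_gridT_sub_smul (by lia) (by lia) hodd _ _
  | adS_gridT_one => exact isHomogeneous_adS_gridT_sub_smul (by lia) (by lia) rfl _ _
  | adS_gridT hm hm' => exact isHomogeneous_adS_gridT_sub_smul (by lia) (by lia) rfl _ _
  | adS_genS =>
    exact ⟨0, sub_mem adS_genS_mem_part (Submodule.smul_mem _ _
      (gridT_mem_part_zero (by lia) (by lia) dvd_rfl _))⟩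
  | adD_gridT_two_mul_two_mul => exact ⟨0, adD_mem_part (heven _)⟩
  | adS_gridT_two_mul_two_mul => exact ⟨_, adS_mem_part (heven _)⟩
  | adS_gridT_one_two => exact isHomogeneous_adS_gridT_sub_smul (by lia) (by lia) rfl _ _

/-- The elements of the free Lie superalgebra that are linear combinations of the elements `T_m^k`
modulo the ideal generated by the relations. -/
noncomputable def gridSpan (n : ℕ) (b : ℕ → ℂ) (c : ℕ → ℕ → ℂ) (d : ℂ) :
    Submodule ℂ FreeSylvester :=
  Submodule.span ℂ (Set.range fun x : Fin (2 * n) × Fin (2 * n) => gridT n (x.2 + 1) (x.1 + 1)) ⊔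
    (freeLieSuperalgebra sylvesterParity).idealSpan (gridRelations n b c d)

namespace IsGridRelation

variable {x : FreeSylvester}

theorem mem_idealSpan (hx : IsGridRelation n b c d x) :
    x ∈ (freeLieSuperalgebra sylvesterParity).idealSpan (gridRelations n b c d) :=
  LieSuperalgebra.subset_idealSpan _ (mem_gridRelations.2 hx)

theorem mem_gridSpan (hx : IsGridRelation n b c d x) : x ∈ gridSpan n b c d :=
  Submodule.mem_sup_right hx.mem_idealSpan

theorem adD_mem_gridSpan (hx : IsGridRelation n b c d x) : adD x ∈ gridSpan n b c d :=
  Submodule.mem_sup_right (LieSuperalgebra.bracket_mem_idealSpan genD hx.mem_idealSpan)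

theorem adS_mem_gridSpan (hx : IsGridRelation n b c d x) : adS x ∈ gridSpan n b c d :=
  Submodule.mem_sup_right (LieSuperalgebra.bracket_mem_idealSpan genS hx.mem_idealSpan)

end IsGridRelation

variable {m k : ℕ}

theorem gridT_mem_gridSpan (hm : 1 ≤ m) (hm' : m ≤ 2 * n) (hk : 1 ≤ k) (hk' : k ≤ 2 * n) :
    gridT n m k ∈ gridSpan n b c d := by
  refine Submodule.mem_sup_left (Submodule.subset_span
    ⟨(⟨k - 1, by lia⟩, ⟨m - 1, by lia⟩), ?_⟩)
  simp only [Nat.sub_add_cancel hm, Nat.sub_add_cancel hk]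

theorem genS_mem_gridSpan (hn : n ≠ 0) (hb : b 1 ≠ 0) : genS ∈ gridSpan n b c d := by
  have h := (IsGridRelation.adD_pow_genS (n := n) (b := b) (c := c) (d := d)).mem_gridSpan
  rw [adD_pow_genS hn] at h
  exact mem_of_sub_smul_mem_of_ne_zero h hb (gridT_mem_gridSpan (by lia) (by lia) (by lia) le_rfl)

theorem genD_mem_gridSpan (hn : n ≠ 0) (hc : c (2 * n - 1) 1 ≠ 0) : genD ∈ gridSpan n b c d := by
  have h := (IsGridRelation.adS_gridT_penultimate (n := n) (b := b) (c := c) (d := d)).mem_gridSpan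
  rw [adS_gridT_penultimate hn] at h
  exact mem_of_sub_smul_mem_of_ne_zero h hc (gridT_mem_gridSpan (by lia) le_rfl le_rfl (by lia))

theorem adD_gridT_two_mul_mem_gridSpan (hk : 1 ≤ k) (hk' : k ≤ 2 * n) :
    adD (gridT n (2 * n) k) ∈ gridSpan n b c d := by
  rcases hk.eq_or_lt with rfl | hk
  · have h := IsGridRelation.adS_gridT_penultimate (n := n) (b := b) (c := c) (d := d)
      |>.adD_mem_gridSpan
    rwa [map_sub, map_smul, adD_genD, smul_zero, sub_zero, adS_gridT_penultimate (by lia)] at h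
  rcases hk'.eq_or_lt with rfl | hk'
  · exact IsGridRelation.adD_gridT_two_mul_two_mul.mem_gridSpan
  rcases eq_or_ne k n with rfl | hkn
  · exact IsGridRelation.gridT_two_mul_self.adD_mem_gridSpan
  · exact (IsGridRelation.adD_gridT_two_mul hk (by lia) hkn).mem_gridSpan

theorem adS_gridT_two_mul_mem_gridSpan (hk : 1 ≤ k) (hk' : k ≤ 2 * n) :
    adS (gridT n (2 * n) k) ∈ gridSpan n b c d := by
  rcases hk.eq_or_lt with rfl | hk
  · have h := IsGridRelation.adS_gridT_penultimate (n := n) (b := b) (c := c) (d := d)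
      |>.adS_mem_gridSpan
    rw [map_sub, map_smul, adS_genD, smul_neg, ← neg_smul, ← gridT_one_one (n := n) (by lia),
      adS_gridT_penultimate (by lia)] at h
    exact mem_of_sub_smul_mem h (gridT_mem_gridSpan le_rfl (by lia) le_rfl (by lia))
  rcases hk'.eq_or_lt with rfl | hk'
  · exact IsGridRelation.adS_gridT_two_mul_two_mul.mem_gridSpan
  rcases eq_or_ne k n with rfl | hkn
  · exact IsGridRelation.gridT_two_mul_self.adS_mem_gridSpan
  · exact mem_of_sub_smul_mem (IsGridRelation.adS_gridT_two_mul hk (by lia) hkn).mem_gridSpan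
      (gridT_mem_gridSpan le_rfl (by lia) (by lia) (by lia))

theorem adD_gridT_one_two_mul_mem_gridSpan (hn : n ≠ 0) :
    adD (gridT n 1 (2 * n)) ∈ gridSpan n b c d := by
  have h := (IsGridRelation.adD_pow_genS (n := n) (b := b) (c := c) (d := d)).adD_mem_gridSpan
  rw [map_sub, map_smul, adD_pow_genS hn, ← gridT_one_one hn] at h
  exact mem_of_sub_smul_mem h (gridT_mem_gridSpan le_rfl (by lia) le_rfl (by lia))

theorem adD_gridT_two_two_mul_mem_gridSpan (hn : 1 < n) (hd : d ≠ 0) :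
    adD (gridT n 2 (2 * n)) ∈ gridSpan n b c d := by
  have h := (IsGridRelation.adS_genS (n := n) (b := b) (c := c) (d := d)).adD_mem_gridSpan
  rw [map_sub, map_smul, adD_adS_genS, ← gridT_one_one (n := n) (by lia),
    adS_gridT_one le_rfl (by lia)] at h
  exact mem_of_sub_smul_mem_of_ne_zero h hd
    (Submodule.smul_mem _ _ (gridT_mem_gridSpan (by lia) (by lia) le_rfl (by lia)))

theorem adD_gridT_mem_gridSpan (hn : 1 < n) (hd : d ≠ 0) (hm : 1 ≤ m) (hm' : m ≤ 2 * n)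
    (hk : 1 ≤ k) (hk' : k ≤ 2 * n) : adD (gridT n m k) ∈ gridSpan n b c d := by
  rcases hm'.eq_or_lt with rfl | hm'
  · exact adD_gridT_two_mul_mem_gridSpan hk hk'
  rcases hk'.lt_or_eq with hk' | rfl
  · exact adD_gridT hm' hk ▸ gridT_mem_gridSpan hm hm'.le (by lia) hk'
  rcases hm.eq_or_lt with rfl | hm
  · exact adD_gridT_one_two_mul_mem_gridSpan (by lia)
  rcases Nat.eq_or_lt_of_le hm with rfl | hm
  · exact adD_gridT_two_two_mul_mem_gridSpan hn hd
  · rw [adD_gridT hm' hk, add_comm, ← adD_pow_gridT hm' _ le_rfl]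
    exact mem_of_sub_smul_mem (IsGridRelation.adD_pow_gridT hm (by lia)).mem_gridSpan
      (gridT_mem_gridSpan (by lia) hm'.le le_rfl (by lia))

theorem adS_gridT_one_two_mul_mem_gridSpan (hn : n ≠ 0) :
    adS (gridT n 1 (2 * n)) ∈ gridSpan n b c d := by
  have h := (IsGridRelation.adD_pow_genS (n := n) (b := b) (c := c) (d := d)).adS_mem_gridSpan
  rw [map_sub, map_smul, adD_pow_genS hn] at h
  exact mem_of_sub_smul_mem h (mem_of_sub_smul_mem IsGridRelation.adS_genS.mem_gridSpan
    (gridT_mem_gridSpan (by lia) (by lia) (by lia) le_rfl))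

theorem adS_gridT_one_mem_gridSpan (hn : 1 < n) (hk : 2 ≤ k) (hk' : k ≤ 2 * n) :
    adS (gridT n 1 k) ∈ gridSpan n b c d := by
  have hmem : gridT n 2 k ∈ gridSpan n b c d :=
    gridT_mem_gridSpan (by lia) (by lia) (by lia) hk'
  rcases hk.eq_or_lt with rfl | hk
  · exact mem_of_sub_smul_mem IsGridRelation.adS_gridT_one_two.mem_gridSpan hmem
  rcases hk'.eq_or_lt with rfl | hk'
  · exact adS_gridT_one_two_mul_mem_gridSpan (by lia)
  · exact mem_of_sub_smul_mem (IsGridRelation.adS_gridT_one hk (by lia)).mem_gridSpan hmem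

theorem adS_gridT_mem_gridSpan (hn : 1 < n) (hm : 1 ≤ m) (hm' : m ≤ 2 * n) (hk : 1 ≤ k)
    (hk' : k ≤ 2 * n) : adS (gridT n m k) ∈ gridSpan n b c d := by
  rcases hm'.eq_or_lt with rfl | hm'
  · exact adS_gridT_two_mul_mem_gridSpan hk hk'
  rcases eq_or_ne m (2 * n - 1) with rfl | hmn
  · exact adS_gridT_penultimate (n := n) (by lia) k ▸ gridT_mem_gridSpan (by lia) le_rfl hk hk'
  rcases hk.eq_or_lt with rfl | hk
  · exact adS_gridT_one (n := n) hm (by lia) ▸ gridT_mem_gridSpan (by lia) (by lia) le_rfl (by lia)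
  rcases hm.eq_or_lt with rfl | hm
  · exact adS_gridT_one_mem_gridSpan hn hk hk'
  · exact mem_of_sub_smul_mem (IsGridRelation.adS_gridT hm (by lia) hk hk').mem_gridSpan
      (gridT_mem_gridSpan (by lia) (by lia) (by lia) hk')

theorem gridSpan_eq_top (hn : 1 < n) (hb : b 1 ≠ 0) (hc : c (2 * n - 1) 1 ≠ 0) (hd : d ≠ 0) :
    gridSpan n b c d = ⊤ := by
  refine span_sup_idealSpan_eq_top ?_ ?_
  · rintro (_ | _)
    exacts [genD_mem_gridSpan (by lia) hc, genS_mem_gridSpan (by lia) hb]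
  · rintro (_ | _) ⟨k, m⟩
    exacts [adD_gridT_mem_gridSpan hn hd (by lia) (by lia) (by lia) (by lia),
      adS_gridT_mem_gridSpan hn (by lia) (by lia) (by lia) (by lia)]

end GridRelations

/-! ### The defining relations for `n > 1` -/

section DefiningRelations

variable {n : ℕ}

theorem relationNumber_le {s : Set FreeSylvester} (hs : IsDefiningSet n s) :
    relationNumber n ≤ s.encard :=
  iInf₂_le s hs

/-- The coefficient `b_m` in `(ad D)^{2n} T_m^1 = b_m T_m^1`. -/
noncomputable def rowCoeff (n m : ℕ) : ℂ :=
  (1 - sylvesterRoot n ^ m) ^ (2 * n)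

/-- The coefficient `d` in `[S, S] = d T_2^{2n}`. -/
noncomputable def squareCoeff (n : ℕ) : ℂ :=
  2 / gridCoeff n 2 (2 * n)

/-- The relations for `n > 1`, with the coefficients for which they hold between Sylvester's
matrices. -/
noncomputable def sylvesterRelations (n : ℕ) : Set FreeSylvester :=
  gridRelations n (rowCoeff n) (stepCoeff n) (squareCoeff n)

theorem sylvesterEval_eq_zero_of_mem_sylvesterRelations (hn : 1 < n) :
    ∀ x ∈ sylvesterRelations n, sylvesterEval n x = 0 := by
  intro x hx
  cases mem_gridRelations.1 hx with
  | adD_pow_genS => exact sylvesterEval_adD_pow_sub_smul sylvesterEval_genS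
  | adS_gridT_penultimate => exact sylvesterEval_adS_gridT_penultimate_sub_smul (by lia)
  | adD_pow_gridT =>
    exact sylvesterEval_adD_pow_sub_smul (sylvesterEval_gridT (by lia) (by lia) le_rfl)
  | gridT_two_mul_self => exact sylvesterEval_gridT_two_mul_self hn
  | adD_gridT_two_mul => exact sylvesterEval_adD_gridT_two_mul (by lia) (by lia)
  | adS_gridT_two_mul => exact sylvesterEval_adS_gridT_two_mul_sub_smul hn (by lia)
  | adS_gridT_one => exact sylvesterEval_adS_gridT_sub_smul hn le_rfl (by lia) (by lia)
  | adS_gridT => exact sylvesterEval_adS_gridT_sub_smul hn (by lia) (by lia) (by lia)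
  | adS_genS => exact sylvesterEval_adS_genS_sub_smul hn
  | adD_gridT_two_mul_two_mul => exact sylvesterEval_adD_gridT_two_mul (by lia) (by lia)
  | adS_gridT_two_mul_two_mul => exact sylvesterEval_adS_gridT_two_mul_two_mul (by lia)
  | adS_gridT_one_two => exact sylvesterEval_adS_gridT_sub_smul hn le_rfl (by lia) (by lia)

theorem gridSpan_coeff_eq_top (hn : 1 < n) :
    gridSpan n (rowCoeff n) (stepCoeff n) (squareCoeff n) = ⊤ := by
  refine gridSpan_eq_top hn (pow_ne_zero _ (one_sub_sylvesterRoot_pow_ne_zero le_rfl (by lia))) ?_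
    (div_ne_zero two_ne_zero (gridCoeff_ne_zero_of_lt hn (by lia) (by lia) _))
  rw [stepCoeff, if_pos rfl, Ne, gridCoeff_eq_zero_iff hn (by lia) le_rfl le_rfl (by lia)]
  lia

theorem isDefiningSet_sylvesterRelations (hn : 1 < n) :
    IsDefiningSet n (sylvesterRelations n) := by
  refine ⟨isHomogeneous_of_mem_gridRelations hn,
    (sylvesterEval n).idealSpan_eq_ker_of_span_sup_eq_top
      (sylvesterEval_eq_zero_of_mem_sylvesterRelations hn)
      (linearIndependent_clockShiftMonomial (isPrimitiveRoot_sylvesterRoot (by lia)) 1 1)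
      (fun x => sylvesterEval_gridT (by lia) (by lia) (by lia)) (fun x hx => ?_)
      (gridSpan_coeff_eq_top hn)⟩
  obtain ⟨hm, hk⟩ := (gridCoeff_eq_zero_iff hn (by lia) (by lia) (by lia) (by lia)).1 hx
  rw [hm, hk]
  exact IsGridRelation.gridT_two_mul_self.mem_idealSpan

theorem supertrace_clockShiftMonomial_eq_zero_iff {k m : ℕ} (hn : n ≠ 0) (hm : 1 ≤ m)
    (hm' : m ≤ 2 * n) (hk : 1 ≤ k) (hk' : k ≤ 2 * n) :
    supertrace (alternating n) (clockShiftMonomial (2 * n) (sylvesterRoot n) k m) = 0 ↔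
      ¬(m = 2 * n ∧ k = n) := by
  have hdvd : 2 * n ∣ m ↔ m = 2 * n :=
    ⟨fun h => hm'.antisymm (Nat.le_of_dvd hm h), fun h => dvd_of_eq h.symm⟩
  rw [supertrace_clockShiftMonomial (isPrimitiveRoot_sylvesterRoot hn) hn, ← hdvd,
    ← two_mul_dvd_add_iff hk hk']
  exact (Nat.cast_ne_zero.2 (by positivity)).ite_eq_right_iff

theorem sylvesterSpan_eq_slSuper (hn : 1 < n) : sylvesterSpan n = slSuper (alternating n) := by
  have hroot := isPrimitiveRoot_sylvesterRoot (n := n) (by lia)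
  have htrace (x : Fin (2 * n) × Fin (2 * n)) := supertrace_clockShiftMonomial_eq_zero_iff
    (n := n) (k := x.1 + 1) (m := x.2 + 1) (by lia) (by lia) (by lia) (by lia) (by lia)
  have hcoeff (x : Fin (2 * n) × Fin (2 * n)) := gridCoeff_eq_zero_iff
    (n := n) (k := x.1 + 1) (m := x.2 + 1) hn (by lia) (by lia) (by lia) (by lia)
  rw [sylvesterSpan, slSuper, (sylvesterEval n).range_eq_span_of_span_sup_eq_top
      (sylvesterEval_eq_zero_of_mem_sylvesterRelations hn)
      (fun x => sylvesterEval_gridT (by lia) (by lia) (by lia)) (gridSpan_coeff_eq_top hn),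
    ker_eq_span_image_of_subsingleton (span_clockShiftMonomial hroot 1 1)]
  · simp only [htrace, hcoeff, Ne]
  · intro x hx y hy
    have hx := not_not.1 ((htrace x).not.1 hx)
    have hy := not_not.1 ((htrace y).not.1 hy)
    ext <;> lia

end DefiningRelations

/-! ### Counting the relations for `n > 1` -/

section Counting

variable {α β : Type*}

theorem encard_le_card_of_subset_image {s : Set β} {F : Finset α} {f : α → β}
    (h : s ⊆ f '' F) : s.encard ≤ F.card :=
  (Set.encard_le_encard h).trans ((Set.encard_image_le _ _).trans
    (Set.encard_coe_eq_coe_finsetCard F).le)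

theorem encard_exists_mem_Icc_le (a b : ℕ) (f : ℕ → α) :
    {x | ∃ k, a ≤ k ∧ k ≤ b ∧ x = f k}.encard ≤ (b + 1 - a : ℕ) := by
  rw [← Nat.card_Icc]
  refine encard_le_card_of_subset_image (f := f) ?_
  rintro _ ⟨k, hk, hk', rfl⟩
  exact ⟨k, Finset.mem_coe.2 (Finset.mem_Icc.2 ⟨hk, hk'⟩), rfl⟩

theorem encard_exists_mem_Icc_ne_le {a b j : ℕ} (hj : a ≤ j) (hj' : j ≤ b) (f : ℕ → α) :
    {x | ∃ k, a ≤ k ∧ k ≤ b ∧ k ≠ j ∧ x = f k}.encard ≤ (b - a : ℕ) := by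
  have hcard : ((Finset.Icc a b).erase j).card = b - a := by
    rw [Finset.card_erase_of_mem (Finset.mem_Icc.2 ⟨hj, hj'⟩), Nat.card_Icc]
    lia
  rw [← hcard]
  refine encard_le_card_of_subset_image (f := f) ?_
  rintro _ ⟨k, hk, hk', hkj, rfl⟩
  exact ⟨k, Finset.mem_coe.2 (Finset.mem_erase.2 ⟨hkj, Finset.mem_Icc.2 ⟨hk, hk'⟩⟩), rfl⟩

theorem encard_exists_mem_Icc_mem_Icc_le (a b c a' b' : ℕ) (f : ℕ → ℕ → α) :
    {x | ∃ m k, a ≤ m ∧ m + c ≤ b ∧ a' ≤ k ∧ k ≤ b' ∧ x = f m k}.encard ≤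
      ((b - c + 1 - a) * (b' + 1 - a') : ℕ) := by
  rw [← Nat.card_Icc, ← Nat.card_Icc, ← Finset.card_product]
  refine encard_le_card_of_subset_image (f := fun x => f x.1 x.2) ?_
  rintro _ ⟨m, k, hm, hm', hk, hk', rfl⟩
  exact ⟨(m, k), Finset.mem_coe.2 (Finset.mk_mem_product
    (Finset.mem_Icc.2 ⟨hm, Nat.le_sub_of_add_le hm'⟩) (Finset.mem_Icc.2 ⟨hk, hk'⟩)), rfl⟩

theorem encard_union_le_add {s t : Set α} {a b : ℕ} (hs : s.encard ≤ a) (ht : t.encard ≤ b) :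
    (s ∪ t).encard ≤ (a + b : ℕ) :=
  (Set.encard_union_le s t).trans (Nat.cast_add (R := ℕ∞) a b ▸ add_le_add hs ht)

theorem encard_insert_le_succ {s : Set α} {a : ℕ} (hs : s.encard ≤ a) (x : α) :
    (insert x s).encard ≤ (a + 1 : ℕ) :=
  (Set.encard_insert_le s x).trans (Nat.cast_succ (R := ℕ∞) a ▸ add_le_add_left hs 1)

theorem encard_singleton_le_one (x : α) : ({x} : Set α).encard ≤ (1 : ℕ) :=
  (Set.encard_singleton x).le

theorem encard_pair_le_two (x y : α) : ({x, y} : Set α).encard ≤ (2 : ℕ) :=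
  encard_insert_le_succ (encard_singleton_le_one y) x

end Counting

theorem encard_gridRelations_le {n : ℕ} (hn : 1 < n) (b : ℕ → ℂ) (c : ℕ → ℕ → ℂ) (d : ℂ) :
    (gridRelations n b c d).encard ≤ (((2 * n) ^ 2 - 1 : ℕ) : ℕ∞) := by
  refine (encard_union_le_add (encard_union_le_add (encard_union_le_add (encard_union_le_add
    (encard_union_le_add (encard_union_le_add (encard_union_le_add (encard_union_le_add
    (encard_union_le_add
      (encard_pair_le_two _ _)
      (encard_exists_mem_Icc_le _ _ _))
      (encard_singleton_le_one _))
      (encard_exists_mem_Icc_ne_le hn (by lia) _))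
      (encard_exists_mem_Icc_ne_le hn (by lia) _))
      (encard_exists_mem_Icc_le _ _ _))
      (encard_exists_mem_Icc_mem_Icc_le _ _ _ _ _ _))
      (encard_singleton_le_one _))
      (encard_pair_le_two _ _))
      (encard_singleton_le_one _)).trans ?_
  obtain ⟨r, hr⟩ : ∃ r, 2 * n = r + 3 := ⟨2 * n - 3, by lia⟩
  rw [hr, Nat.cast_le, show r + 3 - 2 + 1 - 2 = r by lia, show r + 3 + 1 - 2 = r + 2 by lia,
    show (r + 3) ^ 2 = r * (r + 2) + 4 * r + 9 by ring]
  lia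

/-! ### The defining relations for `n = 1` -/

/-- The words whose values at Sylvester's matrices for `n = 1` are nonzero multiples of the
monomials `D ^ k * S ^ m` with `k, m < 2`. -/
noncomputable def gridOne (x : Fin (2 * 1) × Fin (2 * 1)) : FreeSylvester :=
  !![adS genS, genS; genD, adD genS] x.1 x.2

/-- The coefficients of the values of `gridOne` at Sylvester's matrices. -/
noncomputable def gridOneCoeff (x : Fin (2 * 1) × Fin (2 * 1)) : ℂ :=
  !![2, 1; 1, 2] x.1 x.2

theorem gridOneCoeff_ne_zero (x : Fin (2 * 1) × Fin (2 * 1)) : gridOneCoeff x ≠ 0 := by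
  obtain ⟨i, j⟩ := x
  fin_cases i <;> fin_cases j <;> simp [gridOneCoeff]

theorem sylvesterEval_one_adS_genS : sylvesterEval 1 (adS genS) =
    (2 : ℂ) • clockShiftMonomial (2 * 1) (sylvesterRoot 1) 0 0 := by
  rw [sylvesterEval_adS_of_eq sylvesterEval_genS,
    ← clockShiftMonomial_add_period_right (N := 2 * 1) 0 0]
  norm_num

theorem sylvesterEval_one_adD_genS : sylvesterEval 1 (adD genS) =
    (2 : ℂ) • clockShiftMonomial (2 * 1) (sylvesterRoot 1) 1 1 := by
  rw [sylvesterEval_adD_of_eq sylvesterEval_genS, sylvesterRoot_one]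
  norm_num

theorem sylvesterEval_gridOne (x : Fin (2 * 1) × Fin (2 * 1)) :
    sylvesterEval 1 (gridOne x) = gridOneCoeff x •
      clockShiftMonomial (2 * 1) (sylvesterRoot 1) (x.1 + 0) (x.2 + 0) := by
  obtain ⟨i, j⟩ := x
  fin_cases i <;> fin_cases j
  exacts [sylvesterEval_one_adS_genS, sylvesterEval_genS, sylvesterEval_genD,
    sylvesterEval_one_adD_genS]

theorem sylvesterEval_eq_zero_of_mem_relationsOne :
    ∀ x ∈ relationsOne, sylvesterEval 1 x = 0 := by
  have hcoeff : (1 - sylvesterRoot 1 ^ 1) ^ (2 * 1) = 4 := by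
    rw [sylvesterRoot_one]
    norm_num
  rintro x (rfl | rfl | rfl | rfl)
  · exact hcoeff ▸ sylvesterEval_adD_pow_sub_smul sylvesterEval_genS
  · rw [sylvesterEval_adS_of_eq sylvesterEval_one_adD_genS, sylvesterRoot_one]
    norm_num
  · rw [sylvesterEval_adD_of_eq sylvesterEval_one_adS_genS, pow_zero, sub_self, mul_zero, zero_smul]
  · rw [sylvesterEval_adS_of_eq sylvesterEval_one_adS_genS, pow_zero, pow_zero, sub_self, mul_zero,
      zero_smul]

theorem isHomogeneous_of_mem_relationsOne :
    ∀ x ∈ relationsOne, (freeLieSuperalgebra sylvesterParity).IsHomogeneous x := by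
  rintro x (rfl | rfl | rfl | rfl)
  · exact ⟨1, sub_mem (adD_mem_part (adD_mem_part genS_mem_part))
      (Submodule.smul_mem _ _ genS_mem_part)⟩
  · exact ⟨_, adS_mem_part (adD_mem_part genS_mem_part)⟩
  · exact ⟨0, adD_mem_part adS_genS_mem_part⟩
  · exact ⟨_, adS_mem_part adS_genS_mem_part⟩

theorem span_gridOne_sup_idealSpan_eq_top :
    Submodule.span ℂ (Set.range gridOne) ⊔
      (freeLieSuperalgebra sylvesterParity).idealSpan relationsOne = ⊤ := by
  have hgrid (x) : gridOne x ∈ Submodule.span ℂ (Set.range gridOne) ⊔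
      (freeLieSuperalgebra sylvesterParity).idealSpan relationsOne :=
    Submodule.mem_sup_left (Submodule.subset_span ⟨x, rfl⟩)
  have hrel {x} (hx : x ∈ relationsOne) : x ∈ Submodule.span ℂ (Set.range gridOne) ⊔
      (freeLieSuperalgebra sylvesterParity).idealSpan relationsOne :=
    Submodule.mem_sup_right (LieSuperalgebra.subset_idealSpan _ hx)
  refine span_sup_idealSpan_eq_top ?_ ?_
  · rintro (_ | _)
    exacts [hgrid (1, 0), hgrid (0, 1)]
  · rintro (_ | _) ⟨k, m⟩ <;> fin_cases k <;> fin_cases m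
    · exact hrel (.inr (.inr (.inl rfl)))
    · exact hgrid (1, 1)
    · exact adD_genD.symm ▸ zero_mem _
    · exact mem_of_sub_smul_mem (hrel (.inl rfl)) (hgrid (0, 1))
    · exact hrel (.inr (.inr (.inr rfl)))
    · exact hgrid (0, 0)
    · exact adS_genD.symm ▸ neg_mem (hgrid (1, 1))
    · exact hrel (.inr (.inl rfl))

theorem isDefiningSet_relationsOne : IsDefiningSet 1 relationsOne :=
  ⟨isHomogeneous_of_mem_relationsOne, (sylvesterEval 1).idealSpan_eq_ker_of_span_sup_eq_top
    sylvesterEval_eq_zero_of_mem_relationsOne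
    (linearIndependent_clockShiftMonomial (isPrimitiveRoot_sylvesterRoot one_ne_zero) 0 0)
    sylvesterEval_gridOne (fun x hx => absurd hx (gridOneCoeff_ne_zero x))
    span_gridOne_sup_idealSpan_eq_top⟩

theorem sylvesterSpan_one : sylvesterSpan 1 = ⊤ := by
  rw [sylvesterSpan, (sylvesterEval 1).range_eq_span_of_span_sup_eq_top
    sylvesterEval_eq_zero_of_mem_relationsOne sylvesterEval_gridOne
    span_gridOne_sup_idealSpan_eq_top]
  simp only [gridOneCoeff_ne_zero, ne_eq, not_false_eq_true, Set.ofPred_true, Set.image_univ]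
  exact span_clockShiftMonomial (isPrimitiveRoot_sylvesterRoot one_ne_zero) 0 0

theorem encard_relationsOne_le : relationsOne.encard ≤ 4 :=
  encard_insert_le_succ (encard_insert_le_succ (encard_pair_le_two _ _) _) _

theorem mainTheorem4 (n : ℕ) (hn : 1 ≤ n) :
    (n = 1 →
      sylvesterSpan n = ⊤ ∧
      IsDefiningSet n relationsOne ∧
      relationNumber n ≤ 4) ∧
    (1 < n →
      sylvesterSpan n = slSuper (alternating n) ∧
      relationNumber n ≤ (((2 * n) ^ 2 - 1 : ℕ) : ℕ∞) ∧
      (∃ z : ℂ, z ≠ 0 ∧ (sylvesterEval n).toLinearMap (gridT n (2 * n) (2 * n)) = z • 1) ∧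
      LinearIndependent ℂ ![adD (adS (adD genS)), adS (adD (adD genS))] ∧
      ∃ (b : ℕ → ℂ) (c : ℕ → ℕ → ℂ) (d : ℂ),
        IsDefiningSet n
          (relationsGrid n b c d ∪ relationsIdentity n ∪ {relationTwoTwo n (c 1 2)}) ∧
        (relationsGrid n b c d ∪ relationsIdentity n ∪ {relationTwoTwo n (c 1 2)}).encard ≤
          (((2 * n) ^ 2 - 1 : ℕ) : ℕ∞)) := by
  refine ⟨?_, fun h => ⟨sylvesterSpan_eq_slSuper h,
    (relationNumber_le (isDefiningSet_sylvesterRelations h)).trans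
      (encard_gridRelations_le h _ _ _),
    ⟨gridCoeff n (2 * n) (2 * n), ?_, sylvesterEval_gridT_two_mul_two_mul (by lia)⟩,
    linearIndependent_paths_to_two_two, rowCoeff n, stepCoeff n, squareCoeff n,
    isDefiningSet_sylvesterRelations h, encard_gridRelations_le h _ _ _⟩⟩
  · rintro rfl
    exact ⟨sylvesterSpan_one, isDefiningSet_relationsOne,
      (relationNumber_le isDefiningSet_relationsOne).trans encard_relationsOne_le⟩
  · rw [Ne, gridCoeff_eq_zero_iff h (by lia) le_rfl (by lia) le_rfl]
    lia
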